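/- Let $U,X$ be finite-dimensional complex normed spaces, $m\ge 1$, $0=t_0<t_1<\dots<t_m$, $A_j\in\operatorname{End}(X)$ and $B_j\in\operatorname{Hom}(U,X)$ for $0\le j\le m$. Let $\mathcal P$ be the set of pairs $(u,x)$ of smooth functions $u:[0,\infty)\to U$, $x:[0,\infty)\to X$ such that $$\dot x(t)=\sum_{j=0}^m\bigl(A_jx(t-t_j)+B_ju(t-t_j)\bigr)\qquad\text{for all } t\ge t_m .$$ Let $p(t)\in\operatorname{End}(X)$ (for $t\ge t_m$), $f(t,s)\in\operatorname{End}(X)$ (for $t\ge t_m$, $0\le s\le t_m$) and $g(t,s)\in\operatorname{Hom}(U,X)$ (for $t\ge t_m$, $s\ge0$) be the kernels of the solution formula $$x(t)=p(t)x(t_m)+\int_0^{t_m}f(t,s)x(s)\,ds+\int_0^tg(t,s)u(s)\,ds\qquad(t\ge t_m)$$ for this equation. Explicitly, put $p_0(t)=e^{A_0(t-t_m)}$, $$f_0(t,s)=\sum_{j=1}^me^{A_0(t-t_j-s)}A_j\mathbf 1_{\{t_m-t_j\le s\le t-t_j\}},\qquad g_0(t,s)=\sum_{j=0}^me^{A_0(t-t_j-s)}B_j\mathbf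 1_{\{t_m-t_j\le s\le t-t_j\}},$$ and for $k\ge1$ $$p_k(t)=p_0(t)+\int_{t_m}^{t_m+kt_1}f_0(t,r)p_{k-1}(r)\,dr,\qquad f_k(t,s)=f_0(t,s)+\int_{t_m}^{t_m+kt_1}f_0(t,r)f_{k-1}(r,s)\,dr,$$ $$g_k(t,s)=g_0(t,s)+\int_{t_m}^{t_m+kt_1}f_0(t,r)g_{k-1}(r,s)\,dr;$$ then $p(t)=p_k(t)$, $f(t,s)=f_k(t,s)$, $g(t,s)=g_k(t,s)$ with $k=\lceil (t-t_m)/t_1\rceil$. Let $\mathcal P_d$ be the set of pairs of sequences $(u_d,x_d)$, indexed by $k\in\{0,1,2,\dots\}$, with $u_d[k]\in C^0([0,t_m],U)$, $x_d[k]\in C^0([0,t_m],X)$ and $$x_d[k+1]=Px_d[k]+Qu_d[k]+Ru_d[k+1]\qquad\text{for all }k\ge0,$$ where, for $t\in[0,t_m]$, $$(Pv)(t)=p(t_m+t)v(t_m)+\int_0^{t_m}f(t_m+t,s)v(s)\,ds,$$ $$(Qv)(t)=\int_0^{t_m}g(t_m+t,s)v(s)\,ds,\qquad (Rv)(t)=\int_0^tg(t_m+t,s+t_m)v(s)\,ds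 .$$ A function of time vanishes if it tends to $0$ as time tends to $\infty$ (in the norm of $U$ or $X$ for $\mathcal P$, in the sup norm for $\mathcal P_d$); a smooth function on $[0,\infty)$ vanishes smoothly if all its derivatives of order $k\ge0$ vanish. A relation is stable if $y$ vanishes for every $(0,y)$ in it; it is VIVO if for every $(u,y)$ in it with $u$ vanishing, $y$ vanishes; it is smoothly VIVO if for every $(u,y)$ in it with $u$ smoothly vanishing, $y$ vanishes smoothly. The following are equivalent: (a) if $(0,x_d)\in\mathcal P_d$ and, for some $\lambda\in\mathbb C$ with $|\lambda|\ge1$, $x_d[k+1]=\lambda x_d[k]$ for all $k\ge0$, then $x_d=0$; (b) $\mathcal P_d$ is stable; (c) $\mathcal P_d$ is VIVO; (d) $\mathcal P$ is VIVO; (e) $\mathcal P$ is smoothly VIVO; (f) $\mathcal P$ is stable. -/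

import Mathlib

open Set Filter Topology
open scoped ContDiff

noncomputable section

/-! ### Input-output relations

The set of times `T` is `ℝ` (continuous time, where only the restriction of a signal to `[0, ∞)`
is ever used) or `ℕ` (discrete time). A relation is a set of input-output pairs of signals. -/

/-- A signal vanishes if it tends to `0` as time goes to infinity. -/
def Vanishes {T Y : Type*} [Preorder T] [Zero Y] [TopologicalSpace Y] (y : T → Y) : Prop :=
  Tendsto y atTop (𝓝 0)

/-- A continuous-time signal on `[0, ∞)` vanishes smoothly if all its derivatives vanish. -/
def VanishesSmoothly {Y : Type*} [NormedAddCommGroup Y] [NormedSpace ℝ Y] (y : ℝ → Y) : Prop :=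
  ∀ k : ℕ, Vanishes (iteratedDerivWithin k y (Ici 0))

/-- A relation is stable if every output for the zero input vanishes. -/
def IsStableRel {T U Y : Type*} [Preorder T] [Zero U] [Zero Y] [TopologicalSpace Y]
    (P : Set ((T → U) × (T → Y))) : Prop :=
  ∀ y : T → Y, ((0 : T → U), y) ∈ P → Vanishes y

/-- Vanishing input, vanishing output. -/
def IsVIVO {T U Y : Type*} [Preorder T] [Zero U] [TopologicalSpace U] [Zero Y]
    [TopologicalSpace Y] (P : Set ((T → U) × (T → Y))) : Prop :=
  ∀ (u : T → U) (y : T → Y), (u, y) ∈ P → Vanishes u → Vanishes y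

/-- Smoothly vanishing input, smoothly vanishing output. -/
def IsSmoothlyVIVO {U Y : Type*} [NormedAddCommGroup U] [NormedSpace ℝ U]
    [NormedAddCommGroup Y] [NormedSpace ℝ Y] (P : Set ((ℝ → U) × (ℝ → Y))) : Prop :=
  ∀ (u : ℝ → U) (y : ℝ → Y), (u, y) ∈ P → VanishesSmoothly u → VanishesSmoothly y

/-! ### Delay differential equations -/

/-- The data of the delay equation `x'(t) = ∑ j, (A j x(t - t_j) + B j u(t - t_j))`,
with delays `0 = t_0 < t_1 < ⋯ < t_m`, where `m ≥ 1`. -/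
structure DelayEquation (U X : Type*) [NormedAddCommGroup U] [NormedSpace ℂ U]
    [NormedAddCommGroup X] [NormedSpace ℂ X] where
  m : ℕ
  one_le_m : 1 ≤ m
  delay : Fin (m + 1) → ℝ
  delay_zero : delay 0 = 0
  delay_strictMono : StrictMono delay
  A : Fin (m + 1) → X →L[ℂ] X
  B : Fin (m + 1) → U →L[ℂ] X

namespace DelayEquation

variable {U X : Type*} [NormedAddCommGroup U] [NormedSpace ℂ U]
  [NormedAddCommGroup X] [NormedSpace ℂ X] (S : DelayEquation U X)

/-- The largest delay `t_m`. -/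
def tmax : ℝ := S.delay (Fin.last S.m)

/-- The smallest positive delay `t_1`. -/
def tmin : ℝ := S.delay ⟨1, Nat.lt_succ_of_le S.one_le_m⟩

theorem tmax_nonneg : 0 ≤ S.tmax := by
  rw [← S.delay_zero]
  exact S.delay_strictMono.monotone (Fin.zero_le _)

/-- The continuous-time relation of the delay equation: smooth pairs `(u, x)` on `[0, ∞)` such
that the equation holds for all `t ≥ t_m`. -/
def rel : Set ((ℝ → U) × (ℝ → X)) :=
  {ux | ContDiffOn ℝ ∞ ux.1 (Ici 0) ∧ ContDiffOn ℝ ∞ ux.2 (Ici 0) ∧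
    ∀ t : ℝ, S.tmax ≤ t → HasDerivAt ux.2
      (∑ j, (S.A j (ux.2 (t - S.delay j)) + S.B j (ux.1 (t - S.delay j)))) t}

/-! The variation of constants formula reads, for `t ≥ t_m`,
`x(t) = p₀(t) x(t_m) + ∫ s in 0..t, f₀(t, s) x(s) + ∫ s in 0..t, g₀(t, s) u(s)`. -/

/-- The matrix exponential `e^{A₀ t}`. -/
def expA (t : ℝ) : X →L[ℂ] X := NormedSpace.exp ((t : ℂ) • S.A 0)

def p₀ (t : ℝ) : X →L[ℂ] X := S.expA (t - S.tmax)

/-- The sum is over the positive delays `t_1, …, t_m`. -/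
def f₀ (t s : ℝ) : X →L[ℂ] X :=
  ∑ j : Fin S.m, (Icc (S.tmax - S.delay j.succ) (t - S.delay j.succ)).indicator
    (fun s => (S.expA (t - S.delay j.succ - s)).comp (S.A j.succ)) s

/-- The sum is over all delays `t_0, …, t_m`. -/
def g₀ (t s : ℝ) : U →L[ℂ] X :=
  ∑ j : Fin (S.m + 1), (Icc (S.tmax - S.delay j) (t - S.delay j)).indicator
    (fun s => (S.expA (t - S.delay j - s)).comp (S.B j)) s

/-! Eliminating the values of `x` on `(t_m, t]` from the right-hand side, by steps of length
`t_1`, yields kernels `p_k`, `f_k`, `g_k` such that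
`x(t) = p_k(t) x(t_m) + ∫ s in 0..t_m, f_k(t, s) x(s) + ∫ s in 0..t, g_k(t, s) u(s)`
for all `t` in `[t_m, t_m + (k + 1) t_1]`. -/

def pStep : ℕ → ℝ → (X →L[ℂ] X)
  | 0, t => S.p₀ t
  | k + 1, t => S.p₀ t +
      ∫ r in S.tmax..(S.tmax + (k + 1 : ℝ) * S.tmin), (S.f₀ t r).comp (pStep k r)

def fStep : ℕ → ℝ → ℝ → (X →L[ℂ] X)
  | 0, t, s => S.f₀ t s
  | k + 1, t, s => S.f₀ t s +
      ∫ r in S.tmax..(S.tmax + (k + 1 : ℝ) * S.tmin), (S.f₀ t r).comp (fStep k r s)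

def gStep : ℕ → ℝ → ℝ → (U →L[ℂ] X)
  | 0, t, s => S.g₀ t s
  | k + 1, t, s => S.g₀ t s +
      ∫ r in S.tmax..(S.tmax + (k + 1 : ℝ) * S.tmin), (S.f₀ t r).comp (gStep k r s)

/-- A number of steps that reaches time `t`: `t ≤ t_m + (k + 1) t_1` for `k = stepCount t`. -/
def stepCount (t : ℝ) : ℕ := ⌈(t - S.tmax) / S.tmin⌉₊

/-- The kernels of the solution formula
`x(t) = p(t) x(t_m) + ∫ s in 0..t_m, f(t, s) x(s) + ∫ s in 0..t, g(t, s) u(s)`, `t ≥ t_m`. -/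
def p (t : ℝ) : X →L[ℂ] X := S.pStep (S.stepCount t) t

def f (t s : ℝ) : X →L[ℂ] X := S.fStep (S.stepCount t) t s

def g (t s : ℝ) : U →L[ℂ] X := S.gStep (S.stepCount t) t s

/-- `(P v)(t) = p(t_m + t) v(t_m) + ∫ s in 0..t_m, f(t_m + t, s) v(s)`. -/
def opP (v : C(Icc (0 : ℝ) S.tmax, X)) (t : Icc (0 : ℝ) S.tmax) : X :=
  S.p (S.tmax + t) (v ⟨S.tmax, S.tmax_nonneg, le_rfl⟩) +
    ∫ s in (0 : ℝ)..S.tmax, S.f (S.tmax + t) s (v (projIcc 0 S.tmax S.tmax_nonneg s))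

/-- `(Q v)(t) = ∫ s in 0..t_m, g(t_m + t, s) v(s)`. -/
def opQ (v : C(Icc (0 : ℝ) S.tmax, U)) (t : Icc (0 : ℝ) S.tmax) : X :=
  ∫ s in (0 : ℝ)..S.tmax, S.g (S.tmax + t) s (v (projIcc 0 S.tmax S.tmax_nonneg s))

/-- `(R v)(t) = ∫ s in 0..t, g(t_m + t, s + t_m) v(s)`. -/
def opR (v : C(Icc (0 : ℝ) S.tmax, U)) (t : Icc (0 : ℝ) S.tmax) : X :=
  ∫ s in (0 : ℝ)..t, S.g (S.tmax + t) (s + S.tmax) (v (projIcc 0 S.tmax S.tmax_nonneg s))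

/-- The discrete-time relation `x[k+1] = P x[k] + Q u[k] + R u[k+1]` between sequences in
`C⁰([0, t_m], U)` and sequences in `C⁰([0, t_m], X)`. -/
def discreteRel :
    Set ((ℕ → C(Icc (0 : ℝ) S.tmax, U)) × (ℕ → C(Icc (0 : ℝ) S.tmax, X))) :=
  {ux | ∀ (k : ℕ) (t : Icc (0 : ℝ) S.tmax),
    ux.2 (k + 1) t = S.opP (ux.2 k) t + S.opQ (ux.1 k) t + S.opR (ux.1 (k + 1)) t}

end DelayEquation

end

noncomputable section

open MeasureTheory

namespace DelayEquation

variable {U X : Type*} [NormedAddCommGroup U] [NormedSpace ℂ U]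
  [NormedAddCommGroup X] [NormedSpace ℂ X] (S : DelayEquation U X)

/-! The operator `P` sends a segment on `[0, t_m]` to the next segment of the homogeneous solution:
it is the time-`t_m` map of the flow (`opP_eq_flow`). This rests on the solution formula
`IsSolution.eq_kernels`, after which the kernels in `P` can be forgotten. On `[t_m, 2 t_m]` the flow
is Lipschitz with a constant linear in the norm of the initial segment, so `P` is compact by
Arzelà–Ascoli. Condition (a) says that `P` has no eigenvalue of modulus at least `1`; by compactness
its spectral radius is then below `1`, and `∑ ‖P ^ n‖ < ∞`
(`summable_norm_pow_of_isCompactOperator`).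

A recursion `x (k + 1) = P (x k) + w k` with `w → 0` now forces `x → 0`
(`tendsto_zero_of_summable_norm_pow`). For (c), `w` comes from `Q` and `R`, of which only
boundedness matters. For (d), a trajectory is cut into segments of length `t_m`, and `w k` is its
deviation from the homogeneous flow over one segment, controlled by the input. (d) gives (e) because
the relation is closed under differentiation; (b) and (f) follow from (c) and (e) by taking zero
input.

Conversely, a geometric trajectory of ratio `|c| ≥ 1` does not decay, so (b) gives (a). For (f) to
(a), the flow of an eigenvector satisfies `x (t + t_m) = c x (t)`; this makes it smooth on all of
`[0, ∞)`, hence a member of the continuous-time relation that does not decay. -/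

theorem tmin_pos : 0 < S.tmin := by
  rw [← S.delay_zero]
  exact S.delay_strictMono (by simp [Fin.lt_def])

theorem delay_nonneg (j : Fin (S.m + 1)) : 0 ≤ S.delay j := by
  rw [← S.delay_zero]
  exact S.delay_strictMono.monotone (Fin.zero_le _)

theorem delay_le_tmax (j : Fin (S.m + 1)) : S.delay j ≤ S.tmax :=
  S.delay_strictMono.monotone (Fin.le_last _)

theorem tmin_le_delay_succ (j : Fin S.m) : S.tmin ≤ S.delay j.succ :=
  S.delay_strictMono.monotone (by simp [Fin.le_def])

theorem tmax_pos : 0 < S.tmax := S.tmin_pos.trans_le (S.delay_le_tmax _)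

theorem expA_zero : S.expA 0 = 1 := by simp [expA, NormedSpace.exp_zero]

/-! ### The exponential of `A 0` and variation of constants -/

section Exponential

variable [CompleteSpace X]

theorem expA_add (s t : ℝ) : S.expA (s + t) = S.expA s * S.expA t := by
  let _ : NormedAlgebra ℚ (X →L[ℂ] X) := NormedAlgebra.restrictScalars ℚ ℂ _
  simp only [expA, Complex.ofReal_add, add_smul]
  refine NormedSpace.exp_add_of_commute ?_
  exact ((Commute.refl _).smul_left _).smul_right _

theorem hasDerivAt_expA (t : ℝ) : HasDerivAt S.expA (S.A 0 * S.expA t) t := by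
  have h := hasDerivAt_exp_smul_const' (𝕂 := ℝ) (S.A 0) t
  simpa only [← Complex.coe_smul] using! h

theorem continuous_expA : Continuous S.expA :=
  continuous_iff_continuousAt.2 fun t => (S.hasDerivAt_expA t).continuousAt

/-- Variation of constants. -/
theorem hasDerivAt_variation (a : ℝ) (c : X) {φ : ℝ → X} (hφ : Continuous φ) (t : ℝ) :
    HasDerivAt (fun t => S.expA (t - a) c + ∫ τ in a..t, S.expA (t - τ) (φ τ))
      (S.A 0 (S.expA (t - a) c + ∫ τ in a..t, S.expA (t - τ) (φ τ)) + φ t) t := by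
  have hcont : Continuous fun τ => S.expA (a - τ) (φ τ) :=
    (S.continuous_expA.comp (continuous_const.sub continuous_id)).clm_apply hφ
  -- Factoring out `e^{A₀ (t - a)}` leaves an integrand independent of `t`, so the product rule and
  -- the fundamental theorem apply.
  have key : ∀ t, S.expA (t - a) c + ∫ τ in a..t, S.expA (t - τ) (φ τ) =
      S.expA (t - a) (c + ∫ τ in a..t, S.expA (a - τ) (φ τ)) := by
    intro t
    rw [map_add, ← ContinuousLinearMap.intervalIntegral_comp_comm _
      (hcont.intervalIntegrable _ _)]
    congr 2
    ext τ
    rw [show t - τ = (t - a) + (a - τ) by ring, expA_add]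
    rfl
  simp_rw [key]
  have h1 : HasDerivAt (fun t => S.expA (t - a)) (S.A 0 * S.expA (t - a)) t := by
    simpa using (S.hasDerivAt_expA (t - a)).comp_sub_const t a
  have h1' := (ContinuousLinearMap.restrictScalarsL ℂ X X ℝ ℝ).hasFDerivAt.comp_hasDerivAt t h1
  have h2 : HasDerivAt (fun t => c + ∫ τ in a..t, S.expA (a - τ) (φ τ))
      (S.expA (a - t) (φ t)) t :=
    (intervalIntegral.integral_hasDerivAt_right (hcont.intervalIntegrable _ _)
      (hcont.stronglyMeasurableAtFilter _ _) hcont.continuousAt).const_add c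
  refine (h1'.clm_apply h2).congr_deriv ?_
  have h3 : S.expA (t - a) (S.expA (a - t) (φ t)) = φ t := by
    rw [← mul_apply_eq_comp, ← expA_add]
    simp [expA_zero]
  change S.A 0 (S.expA (t - a) _) + S.expA (t - a) (S.expA (a - t) (φ t)) = _
  rw [h3]

/-- Uniqueness for the ODE `y' = A₀ y + φ`, whose right-hand side is Lipschitz in `y` with constant
`‖A₀‖`. Right derivatives suffice. -/
theorem eq_variation {a : ℝ} {x φ : ℝ → X} (hx : Continuous x) (hφ : Continuous φ)
    (h : ∀ t, a ≤ t → HasDerivWithinAt x (S.A 0 (x t) + φ t) (Ici t) t) {t : ℝ} (ht : a ≤ t) :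
    x t = S.expA (t - a) (x a) + ∫ τ in a..t, S.expA (t - τ) (φ τ) := by
  have hv := S.hasDerivAt_variation a (x a) hφ
  refine ODE_solution_unique (v := fun t y => S.A 0 y + φ t) (K := ‖S.A 0‖₊) (a := a) (b := t)
    ?_ hx.continuousOn (fun s hs => h s hs.1)
    (fun s _ => (hv s).continuousAt.continuousWithinAt)
    (fun s _ => (hv s).hasDerivWithinAt) ?_ (right_mem_Icc.2 ht)
  · intro t
    exact LipschitzWith.of_dist_le_mul fun y z => by
      rw [dist_add_right]; exact (S.A 0).lipschitz.dist_le_mul y z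
  · simp [expA_zero]

end Exponential

/-- `x` solves the delay equation with inhomogeneity `w` from time `t_m` on. -/
def IsSolution (w x : ℝ → X) : Prop :=
  ∀ t, S.tmax ≤ t → HasDerivWithinAt x (∑ j, S.A j (x (t - S.delay j)) + w t) (Ici t) t

/-- The part of the right-hand side of the delay equation with positive delays. -/
def delayed (x : ℝ → X) (t : ℝ) : X := ∑ j : Fin S.m, S.A j.succ (x (t - S.delay j.succ))

/-- The right-hand side of the variation of constants formula. -/
def variation (w : ℝ → X) (c : X) (x : ℝ → X) (t : ℝ) : X :=
  S.expA (t - S.tmax) c + ∫ τ in S.tmax..t, S.expA (t - τ) (S.delayed x τ + w τ)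

theorem sum_eq_delayed (x : ℝ → X) (t : ℝ) :
    ∑ j, S.A j (x (t - S.delay j)) = S.A 0 (x t) + S.delayed x t := by
  rw [Fin.sum_univ_succ, S.delay_zero, sub_zero, delayed]

theorem continuous_delayed {x : ℝ → X} (hx : Continuous x) : Continuous (S.delayed x) := by
  unfold delayed
  fun_prop

variable {S} in
theorem IsSolution.sub {w w' x x' : ℝ → X} (h : S.IsSolution w x) (h' : S.IsSolution w' x') :
    S.IsSolution (w - w') (x - x') := fun t ht => by
  refine ((h t ht).sub (h' t ht)).congr_deriv ?_
  simp only [Pi.sub_apply, map_sub, Finset.sum_sub_distrib]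
  abel

variable {S} in
theorem IsSolution.const_smul {w x : ℝ → X} (h : S.IsSolution w x) (c : ℂ) :
    S.IsSolution (c • w) (c • x) := fun t ht => by
  refine ((h t ht).const_smul c).congr_deriv ?_
  simp only [Pi.smul_apply, map_smul, smul_add, Finset.smul_sum]

variable {S} in
theorem IsSolution.comp_add {w x : ℝ → X} (h : S.IsSolution w x) {a : ℝ} (ha : 0 ≤ a) :
    S.IsSolution (fun t => w (t + a)) (fun t => x (t + a)) := fun t ht => by
  have h1 := h (t + a) (by linarith)
  have h2 : HasDerivWithinAt (fun t : ℝ => t + a) 1 (Ici t) t :=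
    ((hasDerivAt_id t).add_const a).hasDerivWithinAt
  have h3 := HasDerivWithinAt.scomp (h := fun t : ℝ => t + a) t h1 h2
    (fun s hs => by simpa using hs)
  simpa [Function.comp_def, sub_add_eq_add_sub] using! h3

/-! ### Solutions of the delay equation -/

section Solution

variable {S} [CompleteSpace X] {w x : ℝ → X}

/-- Together with `IsSolution.eq_variation`, this upgrades the right derivatives of `IsSolution` to
derivatives within `[t_m, ∞)`, which are two-sided after `t_m`. -/
theorem hasDerivAt_of_variation (hx : Continuous x) (hw : Continuous w)
    (h : ∀ t, S.tmax ≤ t → x t = S.variation w (x S.tmax) x t) {t : ℝ} (ht : S.tmax ≤ t) :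
    HasDerivWithinAt x (∑ j, S.A j (x (t - S.delay j)) + w t) (Ici S.tmax) t := by
  have := (S.hasDerivAt_variation S.tmax (x S.tmax)
    ((S.continuous_delayed hx).add hw) t).hasDerivWithinAt (s := Ici S.tmax)
  refine (this.congr_of_mem (fun s hs => h s hs) ht).congr_deriv ?_
  rw [sum_eq_delayed, h t ht, add_assoc]
  rfl

theorem IsSolution.eq_variation (h : S.IsSolution w x) (hx : Continuous x) (hw : Continuous w)
    {t : ℝ} (ht : S.tmax ≤ t) : x t = S.variation w (x S.tmax) x t := by
  refine S.eq_variation hx ((S.continuous_delayed hx).add hw) (fun t ht => ?_) ht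
  refine (h t ht).congr_deriv ?_
  rw [sum_eq_delayed, add_assoc]
  rfl

/-- The method of steps. -/
theorem exists_isSolution {v : ℝ → X} (hv : Continuous v) :
    ∃ x : ℝ → X, Continuous x ∧ (∀ t ≤ S.tmax, x t = v t) ∧ S.IsSolution 0 x := by
  let Φ : (ℝ → X) → ℝ → X := fun x t =>
    if t ≤ S.tmax then v t else S.variation 0 (v S.tmax) x t
  let y : ℕ → ℝ → X := fun n => Φ^[n] v
  have hy_succ : ∀ n, y (n + 1) = Φ (y n) := fun n => Function.iterate_succ_apply' Φ n v
  have hΦ : ∀ {x : ℝ → X}, Continuous x → Continuous (Φ x) := by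
    intro x hx
    refine Continuous.if_le hv ?_ continuous_id continuous_const ?_
    · exact continuous_iff_continuousAt.2 fun t => (S.hasDerivAt_variation S.tmax (v S.tmax)
        ((S.continuous_delayed hx).add continuous_zero) t).continuousAt
    · rintro t rfl
      simp [variation, expA_zero]
  have hy : ∀ n, Continuous (y n) := by
    intro n
    induction n with
    | zero => exact hv
    | succ n ih => rw [hy_succ]; exact hΦ ih
  -- All positive delays are at least `t_1`, so `Φ x` up to time `T + t_1` depends only on `x` up to
  -- time `T`: each iteration gains `t_1`.
  have hΦ_congr : ∀ {x x' : ℝ → X} {T : ℝ}, (∀ s ≤ T, x s = x' s) →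
      ∀ s ≤ T + S.tmin, Φ x s = Φ x' s := by
    intro x x' T h s hs
    simp only [Φ]
    split_ifs with hst
    · rfl
    · simp only [variation]
      congr 1
      refine intervalIntegral.integral_congr fun τ hτ => ?_
      rw [uIcc_of_le (not_le.1 hst).le] at hτ
      have : S.delayed x τ = S.delayed x' τ := Finset.sum_congr rfl fun j _ => by
        rw [h _ (by linarith [hτ.2, S.tmin_le_delay_succ j])]
      simp only [this]
  have hy_step : ∀ n : ℕ, ∀ s ≤ S.tmax + n * S.tmin, y (n + 1) s = y n s := by
    intro n
    induction n with
    | zero =>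
      intro s hs
      rw [hy_succ]
      simp only [Nat.cast_zero, zero_mul, add_zero] at hs
      simp [Φ, hs, y]
    | succ n ih =>
      intro s hs
      rw [hy_succ (n + 1)]
      conv_rhs => rw [hy_succ n]
      refine hΦ_congr ih s (hs.trans_eq ?_)
      push_cast
      ring
  have hy_le : ∀ n k : ℕ, n ≤ k → ∀ s ≤ S.tmax + n * S.tmin, y k s = y n s := by
    intro n k hnk s hs
    induction k, hnk using Nat.le_induction with
    | base => rfl
    | succ k hk ih =>
      rw [hy_step k s (hs.trans ?_), ih]
      have : (n : ℝ) ≤ k := by exact_mod_cast hk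
      nlinarith [S.tmin_pos]
  let N : ℝ → ℕ := fun t => ⌈(t - S.tmax) / S.tmin⌉₊
  have hN : ∀ t, t ≤ S.tmax + N t * S.tmin := by
    intro t
    have := Nat.le_ceil ((t - S.tmax) / S.tmin)
    rw [div_le_iff₀ S.tmin_pos] at this
    linarith
  have hN_mono : Monotone N := fun s t hst => Nat.ceil_mono (by
    have := S.tmin_pos
    gcongr)
  -- At each time the iterates are eventually constant; `N t` is an index from which this holds at
  -- `t`.
  let x : ℝ → X := fun t => y (N t) t
  have hx : ∀ T, ∀ s ≤ T, x s = y (N T) s := fun T s hs =>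
    (hy_le _ _ (hN_mono hs) s (hN s)).symm
  have hxc : Continuous x := continuous_iff_continuousAt.2 fun t =>
    (hy (N (t + 1))).continuousAt.congr <| by
      filter_upwards [Iio_mem_nhds (lt_add_one t)] with s hs using (hx (t + 1) s hs.le).symm
  have hxΦ : ∀ t, x t = Φ x t := by
    intro t
    rw [hx t t le_rfl, ← hy_step (N t) t (hN t), hy_succ]
    exact hΦ_congr (T := t) (fun s hs => (hx t s hs).symm) t (by linarith [S.tmin_pos])
  have hxv : ∀ t ≤ S.tmax, x t = v t := fun t ht => by rw [hxΦ]; simp [Φ, ht]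
  refine ⟨x, hxc, hxv, fun t ht => (hasDerivAt_of_variation hxc continuous_zero ?_ ht).mono
    (Ici_subset_Ici.2 ht)⟩
  intro t ht
  rcases ht.eq_or_lt with rfl | ht
  · simp [variation, expA_zero]
  · conv_lhs => rw [hxΦ]
    simp [Φ, ht.not_ge, hxv S.tmax le_rfl]

end Solution


/-! ### A priori bounds for solutions and for the first kernels -/

section Bounds

variable [CompleteSpace X]

theorem exists_norm_expA_le (T : ℝ) : ∃ K, 0 ≤ K ∧ ∀ t ∈ Icc 0 T, ‖S.expA t‖ ≤ K := by
  obtain ⟨K, hK⟩ := isCompact_Icc.exists_bound_of_continuousOn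
    (S.continuous_expA.continuousOn (s := Icc 0 T))
  exact ⟨max K 0, le_max_right _ _, fun t ht => (hK t ht).trans (le_max_left _ _)⟩

omit [CompleteSpace X] in
theorem norm_delayed_le {x : ℝ → X} {t M : ℝ}
    (h : ∀ j : Fin S.m, ‖x (t - S.delay j.succ)‖ ≤ M) :
    ‖S.delayed x t‖ ≤ (∑ j : Fin S.m, ‖S.A j.succ‖) * M := by
  rw [delayed, Finset.sum_mul]
  exact norm_sum_le_of_le _ fun j _ => (S.A j.succ).le_opNorm_of_le (h j)

/-- Solutions on a bounded interval are bounded in terms of their initial values and the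
inhomogeneity. -/
theorem exists_norm_solution_le (T : ℝ) : ∃ C, 0 ≤ C ∧ ∀ (w x : ℝ → X) (M : ℝ), Continuous w →
    Continuous x → S.IsSolution w x → (∀ t ∈ Icc 0 S.tmax, ‖x t‖ ≤ M) →
    (∀ t ∈ Icc S.tmax T, ‖w t‖ ≤ M) → ∀ t ∈ Icc 0 T, ‖x t‖ ≤ C * M := by
  obtain ⟨K, hK0, hK⟩ := S.exists_norm_expA_le T
  set a := ∑ j : Fin S.m, ‖S.A j.succ‖
  have ha : 0 ≤ a := Finset.sum_nonneg fun _ _ => norm_nonneg _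
  have key : ∀ k : ℕ, ∃ C, 0 ≤ C ∧ ∀ (w x : ℝ → X) (M : ℝ), Continuous w →
      Continuous x → S.IsSolution w x → (∀ t ∈ Icc 0 S.tmax, ‖x t‖ ≤ M) →
      (∀ t ∈ Icc S.tmax T, ‖w t‖ ≤ M) → ∀ t ∈ Icc 0 T, t ≤ S.tmax + k * S.tmin →
      ‖x t‖ ≤ C * M := by
    intro k
    induction k with
    | zero =>
      refine ⟨1, zero_le_one, fun w x M _ _ _ h _ t ht htk => ?_⟩
      rw [one_mul]
      exact h t ⟨ht.1, by simpa using htk⟩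
    | succ k ih =>
      obtain ⟨C, hC0, hC⟩ := ih
      -- `K` bounds the exponential, and `a * C + 1` bounds the delayed terms plus `w`, in units of
      -- `M`. The summand `C` covers `t ≤ t_m`.
      refine ⟨C + (K + K * (a * C + 1) * |T|), by positivity,
        fun w x M hw hx hs hM hwM t ht htk => ?_⟩
      have hM0 : 0 ≤ M := (norm_nonneg _).trans (hM 0 ⟨le_rfl, S.tmax_nonneg⟩)
      have hCk := hC w x M hw hx hs hM hwM
      rcases le_or_gt t S.tmax with htm | htm
      · refine (hCk t ht (htm.trans ?_)).trans ?_
        · have := S.tmin_pos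
          have : 0 ≤ (k : ℝ) * S.tmin := by positivity
          linarith
        · gcongr
          exact le_add_of_nonneg_right (by positivity)
      · rw [hs.eq_variation hx hw htm.le, variation]
        have h1 : ‖S.expA (t - S.tmax) (x S.tmax)‖ ≤ K * M :=
          (S.expA (t - S.tmax)).le_of_opNorm_le_of_le
            (hK _ ⟨by linarith, by linarith [ht.2, S.tmax_nonneg]⟩)
            (hM _ (right_mem_Icc.2 S.tmax_nonneg))
        have h2 : ‖∫ τ in S.tmax..t, S.expA (t - τ) (S.delayed x τ + w τ)‖ ≤
            K * (a * (C * M) + M) * |t - S.tmax| := by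
          refine intervalIntegral.norm_integral_le_of_norm_le_const fun τ hτ => ?_
          rw [uIoc_of_le htm.le] at hτ
          refine (S.expA (t - τ)).le_of_opNorm_le_of_le
            (hK _ ⟨by linarith [hτ.2], by linarith [ht.2, S.tmax_nonneg, hτ.1]⟩) ?_
          refine norm_add_le_of_le (S.norm_delayed_le fun j => ?_)
            (hwM _ ⟨hτ.1.le, hτ.2.trans ht.2⟩)
          have := S.delay_le_tmax j.succ
          have := S.tmin_le_delay_succ j
          have := S.tmin_pos
          push_cast at htk
          exact hCk _ ⟨by linarith [hτ.1], by linarith [hτ.2, ht.2]⟩ (by linarith [hτ.2])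
        have h3 : |t - S.tmax| ≤ |T| := by
          rw [abs_of_pos (by linarith)]
          exact le_trans (by linarith [S.tmax_nonneg, ht.2]) (le_abs_self T)
        calc _ ≤ K * M + K * (a * (C * M) + M) * |T| :=
              norm_add_le_of_le h1 (h2.trans (by gcongr))
          _ ≤ C * M + (K * M + K * (a * (C * M) + M) * |T|) :=
              le_add_of_nonneg_left (by positivity)
          _ = _ := by ring
  obtain ⟨C, hC0, hC⟩ := key ⌈(T - S.tmax) / S.tmin⌉₊
  refine ⟨C, hC0, fun w x M hw hx hs hM hwM t ht => hC w x M hw hx hs hM hwM t ht ?_⟩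
  have := Nat.le_ceil ((T - S.tmax) / S.tmin)
  rw [div_le_iff₀ S.tmin_pos] at this
  linarith [ht.2]

/-- The indicator confines the argument of the exponential to `[0, t - t_m]`. The map `d` lets one
statement serve `f₀` (positive delays) and `g₀` (all delays). -/
theorem exists_norm_delay_kernel_le {Y : Type*} [NormedAddCommGroup Y] [NormedSpace ℂ Y]
    {n : ℕ} (d : Fin n → Fin (S.m + 1)) (B : Fin n → Y →L[ℂ] X) (T : ℝ) :
    ∃ C, 0 ≤ C ∧ ∀ t ≤ T, ∀ s, ‖∑ j : Fin n,
      (Icc (S.tmax - S.delay (d j)) (t - S.delay (d j))).indicator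
        (fun s => (S.expA (t - S.delay (d j) - s)).comp (B j)) s‖ ≤ C := by
  obtain ⟨K, hK0, hK⟩ := S.exists_norm_expA_le T
  refine ⟨∑ j, K * ‖B j‖, by positivity, fun t ht s => norm_sum_le_of_le _ fun j _ => ?_⟩
  by_cases hs : s ∈ Icc (S.tmax - S.delay (d j)) (t - S.delay (d j))
  · rw [indicator_of_mem hs]
    refine (ContinuousLinearMap.opNorm_comp_le _ _).trans ?_
    gcongr
    exact hK _ ⟨by linarith [hs.2], by linarith [hs.1, S.tmax_nonneg]⟩
  · rw [indicator_of_notMem hs, norm_zero]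
    positivity

theorem exists_norm_f₀_le (T : ℝ) : ∃ C, 0 ≤ C ∧ ∀ t ≤ T, ∀ s, ‖S.f₀ t s‖ ≤ C :=
  S.exists_norm_delay_kernel_le (fun j : Fin S.m => j.succ) (fun j => S.A j.succ) T

theorem exists_norm_g₀_le (T : ℝ) : ∃ C, 0 ≤ C ∧ ∀ t ≤ T, ∀ s, ‖S.g₀ t s‖ ≤ C :=
  S.exists_norm_delay_kernel_le id S.B T

end Bounds

/-! ### Bounds and measurability of the iterated kernels -/

section IterKernel

variable {Y : Type*} [NormedAddCommGroup Y] [NormedSpace ℂ Y]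

/-- The common recursion of `pStep`, `fStep` and `gStep`. -/
def iterKernel (h : ℝ → ℝ → Y →L[ℂ] X) : ℕ → ℝ → ℝ → Y →L[ℂ] X
  | 0, t, s => h t s
  | k + 1, t, s => h t s +
      ∫ r in S.tmax..(S.tmax + (k + 1 : ℝ) * S.tmin), (S.f₀ t r).comp (iterKernel h k r s)

theorem pStep_eq_iterKernel (k : ℕ) (t s : ℝ) :
    S.pStep k t = S.iterKernel (fun t _ => S.p₀ t) k t s := by
  induction k generalizing t with
  | zero => rfl
  | succ k ih => simp only [pStep, iterKernel, ih]

theorem fStep_eq_iterKernel (k : ℕ) (t s : ℝ) : S.fStep k t s = S.iterKernel S.f₀ k t s := by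
  induction k generalizing t with
  | zero => rfl
  | succ k ih => simp only [fStep, iterKernel, ih]

theorem gStep_eq_iterKernel (k : ℕ) (t s : ℝ) : S.gStep k t s = S.iterKernel S.g₀ k t s := by
  induction k generalizing t with
  | zero => rfl
  | succ k ih => simp only [gStep, iterKernel, ih]

variable {S} [CompleteSpace X] {h : ℝ → ℝ → Y →L[ℂ] X}

/-- Up to step `N` the recursion evaluates kernels only at times in `[t_m, t_m + N t_1]`, so bounds
on that interval propagate by induction. -/
theorem exists_norm_iterKernel_le (N : ℕ)
    (hh : ∃ C, ∀ t ∈ Icc S.tmax (S.tmax + N * S.tmin), ∀ s, ‖h t s‖ ≤ C) :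
    ∃ C, 0 ≤ C ∧ ∀ k ≤ N, ∀ t ∈ Icc S.tmax (S.tmax + N * S.tmin), ∀ s,
      ‖S.iterKernel h k t s‖ ≤ C := by
  obtain ⟨H, hH⟩ := hh
  obtain ⟨F, hF0, hF⟩ := S.exists_norm_f₀_le (S.tmax + N * S.tmin)
  have key : ∀ k : ℕ, ∃ C, 0 ≤ C ∧ (k ≤ N → ∀ t ∈ Icc S.tmax (S.tmax + N * S.tmin), ∀ s,
      ‖S.iterKernel h k t s‖ ≤ C) := by
    intro k
    induction k with
    | zero => exact ⟨|H|, abs_nonneg _, fun _ t ht s => (hH t ht s).trans (le_abs_self H)⟩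
    | succ k ih =>
      obtain ⟨C, hC0, hC⟩ := ih
      refine ⟨|H| + F * C * |S.tmax + (k + 1 : ℝ) * S.tmin - S.tmax|, by positivity,
        fun hk t ht s => norm_add_le_of_le ((hH t ht s).trans (le_abs_self H)) ?_⟩
      refine intervalIntegral.norm_integral_le_of_norm_le_const fun r hr => ?_
      have hkN : (k + 1 : ℝ) ≤ N := by exact_mod_cast hk
      have hpos := S.tmin_pos
      rw [uIoc_of_le (le_add_of_nonneg_right (by positivity))] at hr
      refine (ContinuousLinearMap.opNorm_comp_le _ _).trans ?_
      have h2 : r ≤ S.tmax + N * S.tmin := hr.2.trans (by gcongr)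
      have h1 := hF t ht.2 r
      have h3 := hC (by omega) r ⟨hr.1.le, h2⟩ s
      gcongr
  choose C hC0 hC using key
  refine ⟨∑ k ∈ Finset.range (N + 1), C k, Finset.sum_nonneg fun k _ => hC0 k,
    fun k hk t ht s => (hC k hk t ht s).trans ?_⟩
  exact Finset.single_le_sum (fun i _ => hC0 i) (Finset.mem_range.2 (by omega))

theorem stronglyMeasurable_f₀ : StronglyMeasurable (Function.uncurry S.f₀) := by
  have : Function.uncurry S.f₀ = ∑ j : Fin S.m, fun z : ℝ × ℝ =>
      {z : ℝ × ℝ | S.tmax - S.delay j.succ ≤ z.2 ∧ z.2 ≤ z.1 - S.delay j.succ}.indicator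
        (fun z => (S.expA (z.1 - S.delay j.succ - z.2)).comp (S.A j.succ)) z := by
    ext1 z
    rw [Finset.sum_apply]
    rfl
  rw [this]
  refine Finset.stronglyMeasurable_sum _ fun j _ => StronglyMeasurable.indicator ?_ ?_
  · refine Continuous.stronglyMeasurable ?_
    refine Continuous.clm_comp (S.continuous_expA.comp ?_) continuous_const
    fun_prop
  · refine (IsClosed.inter ?_ ?_).measurableSet
    · exact isClosed_le continuous_const continuous_snd
    · exact isClosed_le continuous_snd (continuous_fst.sub continuous_const)

theorem _root_.MeasureTheory.StronglyMeasurable.clm_comp' {α E F G : Type*} [MeasurableSpace α]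
    [NormedAddCommGroup E] [NormedSpace ℂ E] [NormedAddCommGroup F] [NormedSpace ℂ F]
    [NormedAddCommGroup G] [NormedSpace ℂ G] {a : α → F →L[ℂ] G} {b : α → E →L[ℂ] F}
    (ha : StronglyMeasurable a) (hb : StronglyMeasurable b) :
    StronglyMeasurable fun z => (a z).comp (b z) :=
  (continuous_fst.clm_comp continuous_snd).comp_stronglyMeasurable (ha.prodMk hb)

/-- Joint measurability in `(t, s)` passes through the parameter integral; it is what Fubini needs
in `IsSolution.eq_kernels`. -/
theorem stronglyMeasurable_iterKernel (hh : StronglyMeasurable (Function.uncurry h)) (k : ℕ) :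
    StronglyMeasurable (Function.uncurry (S.iterKernel h k)) := by
  induction k with
  | zero => exact hh
  | succ k ih =>
    have hk : S.tmax ≤ S.tmax + (k + 1 : ℝ) * S.tmin :=
      le_add_of_nonneg_right (mul_nonneg (by positivity) S.tmin_pos.le)
    have : Function.uncurry (S.iterKernel h (k + 1)) = Function.uncurry h + fun z : ℝ × ℝ =>
        ∫ r in Ioc S.tmax (S.tmax + (k + 1 : ℝ) * S.tmin),
          (S.f₀ z.1 r).comp (S.iterKernel h k r z.2) := by
      ext1 z
      simp only [Function.uncurry, iterKernel, Pi.add_apply, intervalIntegral.integral_of_le hk]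
    rw [this]
    refine hh.add (StronglyMeasurable.integral_prod_right (f := fun (z : ℝ × ℝ) r =>
      (S.f₀ z.1 r).comp (S.iterKernel h k r z.2)) ?_)
    refine StronglyMeasurable.clm_comp' ?_ ?_
    · exact stronglyMeasurable_f₀.comp_measurable (g := fun q : (ℝ × ℝ) × ℝ => (q.1.1, q.2))
        (by fun_prop)
    · exact ih.comp_measurable (g := fun q : (ℝ × ℝ) × ℝ => (q.2, q.1.2)) (by fun_prop)

end IterKernel

end DelayEquation

/-! ### The solution formula for the homogeneous equation -/

theorem intervalIntegral_eq_integral_indicator {X : Type*} [NormedAddCommGroup X]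
    [NormedSpace ℝ X] (h : ℝ → X) {a b L : ℝ} (ha : 0 ≤ a) (hab : a ≤ b) (hb : b ≤ L) :
    ∫ s in a..b, h s = ∫ s in (0 : ℝ)..L, (Icc a b).indicator h s := by
  rw [intervalIntegral.integral_of_le hab, intervalIntegral.integral_of_le (by linarith),
    ← integral_Icc_eq_integral_Ioc, ← integral_Icc_eq_integral_Ioc,
    setIntegral_indicator measurableSet_Icc, inter_eq_self_of_subset_right (Icc_subset_Icc ha hb)]

theorem intervalIntegrable_indicator {X : Type*} [NormedAddCommGroup X]
    {h : ℝ → X} (hh : Continuous h) (a b c d : ℝ) :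
    IntervalIntegrable ((Icc a b).indicator h) volume c d := by
  have := hh.intervalIntegrable (μ := volume) c d
  rw [intervalIntegrable_iff] at this ⊢
  exact this.indicator measurableSet_Icc

namespace DelayEquation

variable {U X : Type*} [NormedAddCommGroup U] [NormedSpace ℂ U]
  [NormedAddCommGroup X] [NormedSpace ℂ X] (S : DelayEquation U X)

variable {S} [CompleteSpace X]

omit [CompleteSpace X] in
theorem intervalIntegrable_clm_apply {Y : Type*} [NormedAddCommGroup Y] [NormedSpace ℂ Y]
    {h : ℝ → Y →L[ℂ] X} {y : ℝ → Y} {a b C : ℝ} (hm : StronglyMeasurable h)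
    (hb : ∀ s ∈ uIoc a b, ‖h s‖ ≤ C) (hy : Continuous y) :
    IntervalIntegrable (fun s => h s (y s)) volume a b := by
  obtain ⟨M, hM⟩ := isCompact_uIcc.exists_bound_of_continuousOn (hy.continuousOn (s := uIcc a b))
  rw [intervalIntegrable_iff]
  refine IntegrableOn.of_bound (by simp [uIoc]) (StronglyMeasurable.aestronglyMeasurable ?_)
    (C * M) ?_
  · exact (continuous_fst.clm_apply continuous_snd).comp_stronglyMeasurable
      (hm.prodMk hy.stronglyMeasurable)
  · filter_upwards [ae_restrict_mem measurableSet_uIoc] with s hs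
    exact (h s).le_of_opNorm_le_of_le (hb s hs) (hM s (uIoc_subset_uIcc hs))

/-- Substitute `s = τ - t_j` in each delayed term. The range becomes `[t_m - t_j, t - t_j]`, and
`t_j ≥ t_1` keeps it below `t_m + k t_1`, one step short of the bound on `t`. -/
theorem variation_eq_integral_f₀ {x : ℝ → X} (hx : Continuous x) (k : ℕ) {t : ℝ}
    (ht : t ∈ Icc S.tmax (S.tmax + (k + 1) * S.tmin)) :
    S.variation 0 (x S.tmax) x t = S.p₀ t (x S.tmax) + (∫ s in (0 : ℝ)..S.tmax, S.f₀ t s (x s)) +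
      ∫ s in S.tmax..(S.tmax + k * S.tmin), S.f₀ t s (x s) := by
  have hE := S.continuous_expA
  have hterm : ∀ j : Fin S.m, Continuous fun s =>
      ((S.expA (t - S.delay j.succ - s)).comp (S.A j.succ)) (x s) := fun j =>
    ((hE.comp (by fun_prop)).clm_comp continuous_const).clm_apply hx
  have hf : (fun s => S.f₀ t s (x s)) = fun s => ∑ j : Fin S.m,
      (Icc (S.tmax - S.delay j.succ) (t - S.delay j.succ)).indicator
        (fun s => ((S.expA (t - S.delay j.succ - s)).comp (S.A j.succ)) (x s)) s := by
    ext1 s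
    rw [f₀, sum_apply]
    refine Finset.sum_congr rfl fun j _ => ?_
    by_cases hs : s ∈ Icc (S.tmax - S.delay j.succ) (t - S.delay j.succ)
    · rw [indicator_of_mem hs, indicator_of_mem hs]
    · rw [indicator_of_notMem hs, indicator_of_notMem hs, zero_apply]
  have hint : ∀ a b, IntervalIntegrable (fun s => S.f₀ t s (x s)) volume a b := fun a b => by
    rw [hf]
    have := IntervalIntegrable.sum (μ := volume) (a := a) (b := b) Finset.univ fun j _ =>
      intervalIntegrable_indicator (hterm j) (S.tmax - S.delay j.succ) (t - S.delay j.succ) a b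
    simpa only [Finset.sum_fn] using this
  rw [add_assoc, intervalIntegral.integral_add_adjacent_intervals (hint _ _) (hint _ _)]
  simp only [variation, Pi.zero_apply, add_zero, delayed, map_sum, p₀]
  congr 1
  rw [hf, intervalIntegral.integral_finsetSum
      fun j _ => intervalIntegrable_indicator (hterm j) _ _ _ _,
    intervalIntegral.integral_finsetSum fun j _ => Continuous.intervalIntegrable ?_ _ _]
  · refine Finset.sum_congr rfl fun j _ => ?_
    have h1 := S.delay_le_tmax j.succ
    have h2 := S.tmin_le_delay_succ j
    rw [← intervalIntegral_eq_integral_indicator _ (by linarith) (by linarith [ht.1])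
        (by linarith [ht.2]), ← intervalIntegral.integral_comp_sub_right]
    refine intervalIntegral.integral_congr fun τ _ => ?_
    simp only [ContinuousLinearMap.comp_apply]
    rw [show t - S.delay j.succ - (τ - S.delay j.succ) = t - τ by ring]
  · exact (hE.comp (continuous_const.sub continuous_id)).clm_apply (by fun_prop)

/-- Induction on the number of steps: the values of `x` after `t_m` in the variation formula are
needed only up to one step earlier, where the induction hypothesis expresses them through the
initial segment. Fubini then collects the new kernels. -/
theorem IsSolution.eq_kernels {x : ℝ → X} (hx : Continuous x) (h : S.IsSolution 0 x) (k : ℕ) :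
    ∀ t ∈ Icc S.tmax (S.tmax + (k + 1) * S.tmin),
      x t = S.pStep k t (x S.tmax) + ∫ s in (0 : ℝ)..S.tmax, S.fStep k t s (x s) := by
  induction k with
  | zero =>
    intro t ht
    rw [h.eq_variation hx continuous_zero ht.1, variation_eq_integral_f₀ hx 0 (by simpa using ht)]
    simp [pStep, fStep]
  | succ k ih =>
    intro t ht
    push_cast at ht
    have hpos := S.tmin_pos
    set L := S.tmax + (k + 1 : ℝ) * S.tmin with hL
    have htL : S.tmax ≤ L := le_add_of_nonneg_right (by positivity)
    obtain ⟨F, hF0, hF⟩ := S.exists_norm_f₀_le (S.tmax + (k + 2 : ℕ) * S.tmin)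
    have htT : t ≤ S.tmax + (k + 2 : ℕ) * S.tmin := ht.2.trans_eq (by push_cast; ring)
    have hLT : L ≤ S.tmax + (k + 2 : ℕ) * S.tmin := by
      rw [hL]; push_cast; linarith
    obtain ⟨Cf, hCf0, hCf⟩ := exists_norm_iterKernel_le (S := S) (h := S.f₀) (k + 2)
      ⟨F, fun t ht s => hF t ht.2 s⟩
    have hp : Continuous S.p₀ := S.continuous_expA.comp (by fun_prop)
    obtain ⟨Cp', hCp'⟩ := isCompact_Icc.exists_bound_of_continuousOn
      (hp.continuousOn (s := Icc S.tmax (S.tmax + (k + 2 : ℕ) * S.tmin)))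
    obtain ⟨Cp, hCp0, hCp⟩ := exists_norm_iterKernel_le (S := S) (h := fun t _ => S.p₀ t) (k + 2)
      ⟨Cp', fun t ht s => hCp' t ht⟩
    have mf : StronglyMeasurable fun z : ℝ × ℝ => S.fStep k z.1 z.2 := by
      simp only [fStep_eq_iterKernel]
      exact stronglyMeasurable_iterKernel stronglyMeasurable_f₀ k
    have mp : StronglyMeasurable (S.pStep k) := by
      have : S.pStep k = fun t => S.iterKernel (fun t _ => S.p₀ t) k t 0 :=
        funext fun t => S.pStep_eq_iterKernel k t 0
      rw [this]
      exact (stronglyMeasurable_iterKernel (S := S) (h := fun t _ => S.p₀ t)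
        (hp.stronglyMeasurable.comp_measurable measurable_fst) k).comp_measurable
          (g := fun t : ℝ => (t, (0 : ℝ))) (by fun_prop)
    have mf0 : StronglyMeasurable (S.f₀ t) :=
      stronglyMeasurable_f₀.comp_measurable (g := fun r : ℝ => (t, r)) (by fun_prop)
    have bf : ∀ r ∈ uIoc S.tmax L, ∀ s, ‖(S.f₀ t r).comp (S.fStep k r s)‖ ≤ F * Cf := by
      intro r hr s
      rw [uIoc_of_le htL] at hr
      refine (ContinuousLinearMap.opNorm_comp_le _ _).trans ?_
      have h1 := hF t htT r
      have h2 := hCf k (by omega) r ⟨hr.1.le, hr.2.trans hLT⟩ s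
      rw [← fStep_eq_iterKernel] at h2
      gcongr
    have bp : ∀ r ∈ uIoc S.tmax L, ‖(S.f₀ t r).comp (S.pStep k r)‖ ≤ F * Cp := by
      intro r hr
      rw [uIoc_of_le htL] at hr
      refine (ContinuousLinearMap.opNorm_comp_le _ _).trans ?_
      have h1 := hF t htT r
      have h2 := hCp k (by omega) r ⟨hr.1.le, hr.2.trans hLT⟩ 0
      rw [← pStep_eq_iterKernel] at h2
      gcongr
    have mfc : StronglyMeasurable fun z : ℝ × ℝ => (S.f₀ t z.1).comp (S.fStep k z.1 z.2) :=
      (mf0.comp_measurable measurable_fst).clm_comp' mf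
    -- The integrand is bounded and measurable on a rectangle of finite measure, which justifies
    -- exchanging the two integrals.
    have hint : IntegrableOn (Function.uncurry fun r s => (S.f₀ t r).comp (S.fStep k r s) (x s))
        (uIoc S.tmax L ×ˢ uIoc 0 S.tmax) (volume.prod volume) := by
      obtain ⟨M, hM⟩ := isCompact_uIcc.exists_bound_of_continuousOn
        (hx.continuousOn (s := uIcc 0 S.tmax))
      refine IntegrableOn.of_bound ?_ (StronglyMeasurable.aestronglyMeasurable ?_)
        (F * Cf * M) ?_
      · rw [Measure.prod_prod]
        exact ENNReal.mul_lt_top (by simp [uIoc]) (by simp [uIoc])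
      · exact (continuous_fst.clm_apply continuous_snd).comp_stronglyMeasurable
          (mfc.prodMk (hx.comp continuous_snd).stronglyMeasurable)
      · filter_upwards [ae_restrict_mem (measurableSet_uIoc.prod measurableSet_uIoc)] with z hz
        exact ContinuousLinearMap.le_of_opNorm_le_of_le _ (bf _ hz.1 _)
          (hM _ (uIoc_subset_uIcc hz.2))
    have hintp := hint
    rw [IntegrableOn, ← Measure.prod_restrict] at hintp
    have ip : IntervalIntegrable (fun r => (S.f₀ t r).comp (S.pStep k r)) volume S.tmax L := by
      rw [intervalIntegrable_iff]
      refine IntegrableOn.of_bound (by simp [uIoc]) (mf0.clm_comp' mp).aestronglyMeasurable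
        (F * Cp) ?_
      filter_upwards [ae_restrict_mem measurableSet_uIoc] with r hr using bp r hr
    have if_ : ∀ s, IntervalIntegrable (fun r => (S.f₀ t r).comp (S.fStep k r s)) volume
        S.tmax L := by
      intro s
      rw [intervalIntegrable_iff]
      refine IntegrableOn.of_bound (by simp [uIoc]) (mfc.comp_measurable
        (g := fun r : ℝ => (r, s)) (by fun_prop)).aestronglyMeasurable (F * Cf) ?_
      filter_upwards [ae_restrict_mem measurableSet_uIoc] with r hr using bf r hr s
    have ifk : ∀ r ∈ uIcc S.tmax L,
        IntervalIntegrable (fun s => S.fStep k r s (x s)) volume 0 S.tmax := by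
      intro r hr
      rw [uIcc_of_le htL] at hr
      refine intervalIntegrable_clm_apply (C := Cf)
        (mf.comp_measurable (g := fun s : ℝ => (r, s)) (by fun_prop)) (fun s _ => ?_) hx
      rw [fStep_eq_iterKernel]
      exact hCf k (by omega) r ⟨hr.1, hr.2.trans hLT⟩ s
    have iLeft : IntervalIntegrable
        (fun r => ∫ s in (0 : ℝ)..S.tmax, (S.f₀ t r).comp (S.fStep k r s) (x s)) volume
        S.tmax L := by
      rw [intervalIntegrable_iff]
      have := hintp.integral_prod_left
      simpa only [intervalIntegral.integral_of_le S.tmax_nonneg, uIoc_of_le S.tmax_nonneg]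
        using! this
    have iRight : IntervalIntegrable
        (fun s => ∫ r in S.tmax..L, (S.f₀ t r).comp (S.fStep k r s) (x s)) volume
        0 S.tmax := by
      rw [intervalIntegrable_iff]
      have := hintp.swap.integral_prod_left
      simpa only [intervalIntegral.integral_of_le htL, uIoc_of_le htL] using! this
    have i0 : IntervalIntegrable (fun s => S.f₀ t s (x s)) volume 0 S.tmax :=
      intervalIntegrable_clm_apply mf0 (fun s _ => hF t htT s) hx
    have hA : ∫ r in S.tmax..L, S.f₀ t r (x r) =
        (∫ r in S.tmax..L, (S.f₀ t r).comp (S.pStep k r)) (x S.tmax) +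
        ∫ s in (0 : ℝ)..S.tmax, (∫ r in S.tmax..L, (S.f₀ t r).comp (S.fStep k r s)) (x s) := by
      simp only [ContinuousLinearMap.intervalIntegral_apply ip,
        ContinuousLinearMap.intervalIntegral_apply (if_ _)]
      rw [← intervalIntegral_intervalIntegral_swap hint, ← intervalIntegral.integral_add ?_ iLeft]
      · refine intervalIntegral.integral_congr fun r hr => ?_
        have hr' := hr
        rw [uIcc_of_le htL] at hr'
        simp only [ih r hr', map_add, ContinuousLinearMap.comp_apply]
        rw [ContinuousLinearMap.intervalIntegral_comp_comm _ (ifk r hr)]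
      · exact intervalIntegrable_clm_apply (mf0.clm_comp' mp) bp continuous_const
    rw [h.eq_variation hx continuous_zero ht.1, variation_eq_integral_f₀ hx (k + 1)
      (by push_cast; exact ht)]
    push_cast
    rw [← hL, hA]
    simp only [pStep, fStep, add_apply]
    rw [intervalIntegral.integral_add i0, ← hL]
    · abel
    · simpa only [← hL, ContinuousLinearMap.intervalIntegral_apply (if_ _)] using iRight

end DelayEquation

/-! ### Compact operators without eigenvalues outside the open unit disc -/

section PowerStable

variable {E : Type*} [NormedAddCommGroup E] [NormedSpace ℂ E]

/-- Nonzero spectral values of a compact operator are eigenvalues, so the spectrum lies in the open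
unit disc and the spectral radius is below some `ρ < 1`. Gelfand's formula gives `‖T ^ n‖ ≤ ρ ^ n`
eventually. -/
theorem summable_norm_pow_of_isCompactOperator [CompleteSpace E] {T : E →L[ℂ] E}
    (hT : IsCompactOperator T) (h : ∀ (c : ℂ) (v : E), 1 ≤ ‖c‖ → T v = c • v → v = 0) :
    Summable fun n : ℕ => ‖T ^ n‖ := by
  rcases subsingleton_or_nontrivial E with hE | hE
  · have : ∀ n : ℕ, ‖T ^ n‖ = 0 := fun n => by
      rw [Subsingleton.elim (T ^ n) 0, norm_zero]
    simp only [this]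
    exact summable_zero
  have hr : spectralRadius ℂ T < (1 : NNReal) := by
    refine spectrum.spectralRadius_lt_of_forall_lt _ fun c hc => ?_
    by_contra! hc1
    have hc1' : 1 ≤ ‖c‖ := by exact_mod_cast hc1
    have hc0 : c ≠ 0 := by
      rintro rfl
      norm_num at hc1'
    obtain ⟨v, hv⟩ := ((hT.hasEigenvalue_iff_mem_spectrum hc0).2 hc).exists_hasEigenvector
    exact hv.2 (h c v hc1' hv.apply_eq_smul)
  obtain ⟨ρ, hρ, hρ1⟩ := ENNReal.lt_iff_exists_nnreal_btwn.1 hr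
  have hρ1' : (ρ : ℝ) < 1 := by exact_mod_cast hρ1
  refine Summable.of_norm_bounded_eventually_nat
    (summable_geometric_of_lt_one ρ.coe_nonneg hρ1') ?_
  have := spectrum.pow_nnnorm_pow_one_div_tendsto_nhds_spectralRadius T
  filter_upwards [this.eventually (gt_mem_nhds hρ), eventually_ge_atTop 1] with n hn hn1
  rw [norm_norm]
  have hn0 : (n : ℝ) ≠ 0 := by positivity
  have h2 : (‖T ^ n‖₊ : ENNReal) ≤ ρ ^ n := by
    calc (‖T ^ n‖₊ : ENNReal) = (((‖T ^ n‖₊ : ENNReal) ^ (1 / n : ℝ)) ^ (n : ℝ)) := by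
          rw [← ENNReal.rpow_mul, one_div_mul_cancel hn0, ENNReal.rpow_one]
      _ ≤ (ρ : ENNReal) ^ (n : ℝ) := ENNReal.rpow_le_rpow hn.le n.cast_nonneg
      _ = _ := ENNReal.rpow_natCast _ _
  exact_mod_cast h2

/-- Unrolling the recursion gives `T ^ k` applied to `x 0` plus a convolution of a summable sequence
with a null sequence. -/
theorem tendsto_zero_of_summable_norm_pow {T : E →L[ℂ] E}
    (hT : Summable fun n : ℕ => ‖T ^ n‖) {x w : ℕ → E} (hx : ∀ k, x (k + 1) = T (x k) + w k)
    (hw : Tendsto w atTop (𝓝 0)) : Tendsto x atTop (𝓝 0) := by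
  have hsum : ∀ k, x k = (T ^ k) (x 0) + ∑ i ∈ Finset.range k, (T ^ i) (w (k - 1 - i)) := by
    intro k
    induction k with
    | zero => simp
    | succ k ih =>
      rw [hx, ih, Finset.sum_range_succ', map_add, map_sum, pow_succ']
      simp only [pow_succ', mul_apply_eq_comp, pow_zero, one_apply_eq_self,
        Nat.add_sub_cancel, Nat.sub_zero, add_assoc]
      congr 2
      refine Finset.sum_congr rfl fun i _ => ?_
      rw [show k - 1 - i = k - (i + 1) by omega]
  obtain ⟨W, hW⟩ : ∃ W, ∀ k, ‖w k‖ ≤ W := by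
    obtain ⟨W, hW⟩ := hw.norm.bddAbove_range
    exact ⟨W, fun k => hW ⟨k, rfl⟩⟩
  have h1 : Tendsto (fun k => (T ^ k) (x 0)) atTop (𝓝 0) :=
    squeeze_zero_norm (fun k => (T ^ k).le_opNorm (x 0))
      (by simpa using hT.tendsto_atTop_zero.mul_const ‖x 0‖)
  -- Extending the finite sums by zero allows dominated convergence with majorant `‖T ^ i‖ * W`; the
  -- subtraction in `k - 1 - i` is genuine for `i < k`.
  have h2 : Tendsto (fun k => ∑' i, if i < k then ‖T ^ i‖ * ‖w (k - 1 - i)‖ else 0) atTop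
      (𝓝 (∑' _ : ℕ, (0 : ℝ))) := by
    refine tendsto_tsum_of_dominated_convergence (bound := fun i => ‖T ^ i‖ * W)
      (hT.mul_right W) (fun i => ?_) (Eventually.of_forall fun k i => ?_)
    · have h3 : Tendsto (fun k => ‖T ^ i‖ * ‖w (k - 1 - i)‖) atTop (𝓝 0) := by
        have : Tendsto (fun k : ℕ => k - 1 - i) atTop atTop :=
          (tendsto_sub_atTop_nat i).comp (tendsto_sub_atTop_nat 1)
        simpa using ((hw.comp this).norm.const_mul ‖T ^ i‖)
      refine h3.congr' ?_
      filter_upwards [eventually_gt_atTop i] with k hk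
      rw [if_pos hk]
    · split_ifs
      · rw [Real.norm_of_nonneg (by positivity)]
        gcongr
        exact hW _
      · rw [norm_zero]
        exact mul_nonneg (norm_nonneg _) ((norm_nonneg _).trans (hW 0))
  have h3 : Tendsto (fun k => ∑ i ∈ Finset.range k, (T ^ i) (w (k - 1 - i))) atTop (𝓝 0) := by
    rw [tsum_zero] at h2
    refine squeeze_zero_norm (fun k => ?_) h2
    rw [tsum_eq_sum (s := Finset.range k) (fun i hi => if_neg (by simpa using hi))]
    refine norm_sum_le_of_le _ fun i hi => ?_
    rw [if_pos (Finset.mem_range.1 hi)]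
    exact (T ^ i).le_opNorm _
  have := h1.add h3
  rw [add_zero] at this
  exact this.congr fun k => (hsum k).symm

end PowerStable

/-- Arzelà–Ascoli: for the pointwise topology the set is closed in a product of compact balls, and a
common Lipschitz constant gives equicontinuity. -/
theorem isCompact_setOf_lipschitzWith {α X : Type*} [MetricSpace α] [CompactSpace α]
    [NormedAddCommGroup X] [ProperSpace X] (C : ℝ) (K : NNReal) :
    IsCompact {g : C(α, X) | (∀ t, ‖g t‖ ≤ C) ∧ LipschitzWith K g} := by
  refine ArzelaAscoli.isCompact_of_equicontinuous _ ?_ ?_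
  · have himage : ContinuousMap.toFun '' {g : C(α, X) | (∀ t, ‖g t‖ ≤ C) ∧ LipschitzWith K g} =
        {g : α → X | LipschitzWith K g} ∩ univ.pi fun _ => Metric.closedBall 0 C := by
      ext g
      constructor
      · rintro ⟨g, hg, rfl⟩
        exact ⟨hg.2, fun t _ => by simpa using hg.1 t⟩
      · rintro ⟨hg, hb⟩
        exact ⟨⟨g, hg.continuous⟩, ⟨fun t => by simpa using hb t (mem_univ t), hg⟩, rfl⟩
    rw [himage]
    refine (isCompact_univ_pi fun _ => isCompact_closedBall _ _).inter_left ?_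
    simp only [lipschitzWith_iff_dist_le_mul, ofPred_forall]
    exact isClosed_iInter fun s => isClosed_iInter fun t =>
      isClosed_le ((continuous_apply s).dist (continuous_apply t)) continuous_const
  · exact (LipschitzWith.uniformEquicontinuous _ K fun g => g.2.2).equicontinuous

/-! ### The operator `P` as the time-`t_m` map of the homogeneous flow -/

namespace DelayEquation

variable {U X : Type*} [NormedAddCommGroup U] [NormedSpace ℂ U]
  [NormedAddCommGroup X] [NormedSpace ℂ X] (S : DelayEquation U X)

variable {S} in
theorem IsSolution.add {w w' x x' : ℝ → X} (h : S.IsSolution w x) (h' : S.IsSolution w' x') :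
    S.IsSolution (w + w') (x + x') := fun t ht => by
  refine ((h t ht).add (h' t ht)).congr_deriv ?_
  simp only [Pi.add_apply, map_add, Finset.sum_add_distrib]
  abel

theorem le_stepCount (t : ℝ) : t ≤ S.tmax + (S.stepCount t + 1) * S.tmin := by
  have := Nat.le_ceil ((t - S.tmax) / S.tmin)
  rw [div_le_iff₀ S.tmin_pos] at this
  rw [stepCount]
  linarith [S.tmin_pos]

variable [CompleteSpace X]

variable {S} in
-- Any solution extending `v` may be used. Sums and multiples of flows are such solutions, which
-- makes `P` linear without touching the kernels.
theorem IsSolution.opP_apply {x : ℝ → X} (hx : Continuous x) (h : S.IsSolution 0 x)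
    {v : C(Icc (0 : ℝ) S.tmax, X)} (hv : ∀ t, v t = x t) (t : Icc (0 : ℝ) S.tmax) :
    S.opP v t = x (S.tmax + t) := by
  rw [h.eq_kernels hx _ (S.tmax + t) ⟨by linarith [t.2.1], S.le_stepCount _⟩, opP, hv]
  congr 1
  refine intervalIntegral.integral_congr fun s hs => ?_
  rw [uIcc_of_le S.tmax_nonneg] at hs
  simp only [hv, projIcc_of_mem _ hs]
  rfl

/-- The solution of the homogeneous delay equation with initial values `v` on `[0, t_m]`. -/
def flow (v : C(Icc (0 : ℝ) S.tmax, X)) : ℝ → X :=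
  (exists_isSolution (S := S) (v := fun t => v (projIcc 0 S.tmax S.tmax_nonneg t))
    (v.continuous.comp continuous_projIcc)).choose

variable (v : C(Icc (0 : ℝ) S.tmax, X))

theorem continuous_flow : Continuous (S.flow v) :=
  (exists_isSolution (S := S) (v := fun t => v (projIcc 0 S.tmax S.tmax_nonneg t))
    (v.continuous.comp continuous_projIcc)).choose_spec.1

theorem isSolution_flow : S.IsSolution 0 (S.flow v) :=
  (exists_isSolution (S := S) (v := fun t => v (projIcc 0 S.tmax S.tmax_nonneg t))
    (v.continuous.comp continuous_projIcc)).choose_spec.2.2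

theorem flow_coe (t : Icc (0 : ℝ) S.tmax) : S.flow v t = v t := by
  rw [← congrArg v (projIcc_val S.tmax_nonneg t)]
  exact (exists_isSolution (S := S) (v := fun t => v (projIcc 0 S.tmax S.tmax_nonneg t))
    (v.continuous.comp continuous_projIcc)).choose_spec.2.1 _ t.2.2

theorem opP_eq_flow (t : Icc (0 : ℝ) S.tmax) : S.opP v t = S.flow v (S.tmax + t) :=
  (S.isSolution_flow v).opP_apply (S.continuous_flow v) (fun t => (S.flow_coe v t).symm) t

theorem exists_norm_flow_le : ∃ C, 0 ≤ C ∧ ∀ (v : C(Icc (0 : ℝ) S.tmax, X)),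
    ∀ t ∈ Icc 0 (2 * S.tmax), ‖S.flow v t‖ ≤ C * ‖v‖ := by
  obtain ⟨C, hC0, hC⟩ := S.exists_norm_solution_le (2 * S.tmax)
  refine ⟨C, hC0, fun v => hC 0 (S.flow v) ‖v‖ continuous_zero (S.continuous_flow v)
    (S.isSolution_flow v) (fun t ht => ?_) (fun t _ => by simp)⟩
  rw [S.flow_coe v ⟨t, ht⟩]
  exact v.norm_coe_le_norm _

/-- On `[t_m, 2 t_m]` the equation bounds the derivative by values on `[0, 2 t_m]`. This gain of
regularity is the source of compactness. -/
theorem exists_lipschitz_flow : ∃ K, 0 ≤ K ∧ ∀ (v : C(Icc (0 : ℝ) S.tmax, X)),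
    ∀ s ∈ Icc S.tmax (2 * S.tmax), ∀ t ∈ Icc S.tmax (2 * S.tmax),
      ‖S.flow v t - S.flow v s‖ ≤ K * ‖v‖ * ‖t - s‖ := by
  obtain ⟨C, hC0, hC⟩ := S.exists_norm_flow_le
  refine ⟨∑ j, ‖S.A j‖ * C, by positivity, fun v s hs t ht => ?_⟩
  refine Convex.norm_image_sub_le_of_norm_hasDerivWithin_le
    (f' := fun t => ∑ j, S.A j (S.flow v (t - S.delay j)) + (0 : ℝ → X) t)
    (fun r hr => ?_) (fun r hr => ?_) (convex_Icc _ _) hs ht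
  · exact (hasDerivAt_of_variation (S.continuous_flow v) continuous_zero
      (fun t ht => (S.isSolution_flow v).eq_variation (S.continuous_flow v) continuous_zero ht)
      hr.1).mono Icc_subset_Ici_self
  · rw [Pi.zero_apply, add_zero, Finset.sum_mul]
    refine norm_sum_le_of_le _ fun j _ => ?_
    rw [mul_assoc]
    refine (S.A j).le_opNorm_of_le (hC v _ ⟨?_, ?_⟩)
    · linarith [hr.1, S.delay_le_tmax j]
    · linarith [hr.2, S.delay_nonneg j]

/-- The operator `P` on `C⁰([0, t_m], X)`. -/
def stepOp : C(Icc (0 : ℝ) S.tmax, X) →L[ℂ] C(Icc (0 : ℝ) S.tmax, X) :=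
  LinearMap.mkContinuousOfExistsBound
    { toFun := fun v => ⟨S.opP v, by
        simp only [funext (S.opP_eq_flow v)]
        exact (S.continuous_flow v).comp (by fun_prop)⟩
      map_add' := fun v v' => by
        ext1 t
        simp only [ContinuousMap.coe_mk, ContinuousMap.add_apply]
        rw [IsSolution.opP_apply ((S.continuous_flow v).add (S.continuous_flow v'))
          (by simpa using (S.isSolution_flow v).add (S.isSolution_flow v'))
          (fun t => by simp [flow_coe]), S.opP_eq_flow, S.opP_eq_flow]
        rfl
      map_smul' := fun c v => by
        ext1 t
        simp only [ContinuousMap.coe_mk, ContinuousMap.smul_apply, RingHom.id_apply]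
        rw [IsSolution.opP_apply ((S.continuous_flow v).const_smul c)
          (by simpa using! (S.isSolution_flow v).const_smul c)
          (fun t => by simp [flow_coe]), S.opP_eq_flow]
        rfl }
    (by
      obtain ⟨C, hC0, hC⟩ := S.exists_norm_flow_le
      refine ⟨C, fun v => (ContinuousMap.norm_le _ (by positivity)).2 fun t => ?_⟩
      refine (congrArg norm (S.opP_eq_flow v t)).trans_le (hC v _ ⟨?_, ?_⟩)
      · linarith [t.2.1, S.tmax_nonneg]
      · linarith [t.2.2])

theorem stepOp_apply (t : Icc (0 : ℝ) S.tmax) : S.stepOp v t = S.opP v t := rfl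

theorem isCompactOperator_stepOp [ProperSpace X] : IsCompactOperator S.stepOp := by
  obtain ⟨C, hC0, hC⟩ := S.exists_norm_flow_le
  obtain ⟨K, hK0, hK⟩ := S.exists_lipschitz_flow
  rw [isCompactOperator_iff_exists_mem_nhds_image_subset_compact]
  refine ⟨Metric.ball 0 1, Metric.ball_mem_nhds _ one_pos, _,
    isCompact_setOf_lipschitzWith C ⟨K, hK0⟩, ?_⟩
  rintro _ ⟨v, hv, rfl⟩
  have hv1 : ‖v‖ ≤ 1 := (mem_ball_zero_iff.1 hv).le
  refine ⟨fun t => ?_, LipschitzWith.of_dist_le_mul fun s t => ?_⟩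
  · rw [stepOp_apply, opP_eq_flow]
    refine (hC v _ ⟨?_, ?_⟩).trans (mul_le_of_le_one_right hC0 hv1)
    · linarith [t.2.1, S.tmax_nonneg]
    · linarith [t.2.2]
  · rw [stepOp_apply, stepOp_apply, opP_eq_flow, opP_eq_flow, dist_eq_norm]
    refine (hK v _ ⟨?_, ?_⟩ _ ⟨?_, ?_⟩).trans ?_
    · linarith [t.2.1]
    · linarith [t.2.2]
    · linarith [s.2.1]
    · linarith [s.2.2]
    · rw [add_sub_add_left_eq_sub, Subtype.dist_eq, dist_eq_norm]
      gcongr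
      exact mul_le_of_le_one_right hK0 hv1

end DelayEquation

namespace DelayEquation

variable {U X : Type*} [NormedAddCommGroup U] [NormedSpace ℂ U]
  [NormedAddCommGroup X] [NormedSpace ℂ X] {S : DelayEquation U X}

/-! ### The discrete-time relation -/

section Discrete

theorem opQ_zero (t : Icc (0 : ℝ) S.tmax) : S.opQ 0 t = 0 := by simp [opQ]

theorem opR_zero (t : Icc (0 : ℝ) S.tmax) : S.opR 0 t = 0 := by simp [opR]

variable [CompleteSpace X]

/-- If the geometric trajectories with ratio outside the open unit disc vanish, then `P` has no
eigenvalue there. -/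
theorem eigenvector_eq_zero_of_geometric
    (h : ∀ (x : ℕ → C(Icc (0 : ℝ) S.tmax, X)) (c : ℂ), (0, x) ∈ S.discreteRel → 1 ≤ ‖c‖ →
      (∀ k, x (k + 1) = c • x k) → x = 0)
    (c : ℂ) (v : C(Icc (0 : ℝ) S.tmax, X)) (hc : 1 ≤ ‖c‖) (hv : S.stepOp v = c • v) : v = 0 := by
  have := h (fun k => c ^ k • v) c ?_ hc fun k => by rw [pow_succ', mul_smul]
  · simpa using congrFun this 0
  · intro k t
    simp only [Pi.zero_apply, opQ_zero, opR_zero, add_zero, ← stepOp_apply]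
    rw [map_smul, hv, smul_smul, pow_succ]

theorem stepOp_eq_of_geometric {x : ℕ → C(Icc (0 : ℝ) S.tmax, X)} {c : ℂ}
    (hx : (0, x) ∈ S.discreteRel) (hc : ∀ k, x (k + 1) = c • x k) :
    S.stepOp (x 0) = c • x 0 := by
  rw [← hc 0]
  ext1 t
  have := hx 0 t
  simp only [Pi.zero_apply, opQ_zero, opR_zero, add_zero] at this
  rw [stepOp_apply, ← this]

/-- The step counts of times up to `2 t_m` are at most that of `2 t_m`, so finitely many iterated
kernels are involved. -/
theorem exists_norm_g_le (S : DelayEquation U X) : ∃ C, 0 ≤ C ∧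
    ∀ t ∈ Icc S.tmax (2 * S.tmax), ∀ s, ‖S.g t s‖ ≤ C := by
  obtain ⟨F, _, hF⟩ := S.exists_norm_g₀_le (S.tmax + S.stepCount (2 * S.tmax) * S.tmin)
  obtain ⟨C, hC0, hC⟩ := exists_norm_iterKernel_le (S := S) (h := S.g₀)
    (S.stepCount (2 * S.tmax)) ⟨F, fun t ht => hF t ht.2⟩
  refine ⟨C, hC0, fun t ht s => ?_⟩
  have hpos := S.tmin_pos
  have hN := Nat.le_ceil ((2 * S.tmax - S.tmax) / S.tmin)
  rw [div_le_iff₀ hpos] at hN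
  rw [g, gStep_eq_iterKernel]
  refine hC _ (Nat.ceil_mono ?_) t ⟨ht.1, ?_⟩ s
  · gcongr
    exact ht.2
  · rw [stepCount]
    linarith [ht.2]

theorem exists_norm_opQ_le (S : DelayEquation U X) : ∃ C, 0 ≤ C ∧
    ∀ (u : C(Icc (0 : ℝ) S.tmax, U)) (t : Icc (0 : ℝ) S.tmax),
      ‖S.opQ u t‖ ≤ C * ‖u‖ ∧ ‖S.opR u t‖ ≤ C * ‖u‖ := by
  obtain ⟨C, hC0, hC⟩ := S.exists_norm_g_le
  have htm := S.tmax_nonneg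
  have hg : ∀ (u : C(Icc (0 : ℝ) S.tmax, U)) (t : Icc (0 : ℝ) S.tmax) (s s' : ℝ),
      ‖S.g (S.tmax + t) s (u (projIcc 0 S.tmax S.tmax_nonneg s'))‖ ≤ C * ‖u‖ := fun u t s s' =>
    ContinuousLinearMap.le_of_opNorm_le_of_le _
      (hC _ ⟨by linarith [t.2.1], by linarith [t.2.2]⟩ _) (u.norm_coe_le_norm _)
  refine ⟨C * S.tmax, by positivity, fun u t => ⟨?_, ?_⟩⟩
  · refine (intervalIntegral.norm_integral_le_of_norm_le_const fun s _ => hg u t s s).trans_eq ?_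
    rw [sub_zero, abs_of_nonneg htm]
    ring
  · refine (intervalIntegral.norm_integral_le_of_norm_le_const fun s _ => hg u t _ s).trans ?_
    rw [sub_zero, abs_of_nonneg t.2.1, mul_right_comm]
    gcongr
    exact t.2.2

theorem isVIVO_discreteRel [ProperSpace X]
    (h : ∀ (c : ℂ) (v : C(Icc (0 : ℝ) S.tmax, X)), 1 ≤ ‖c‖ → S.stepOp v = c • v → v = 0) :
    IsVIVO S.discreteRel := by
  intro u x hux hu
  have hsum := summable_norm_pow_of_isCompactOperator S.isCompactOperator_stepOp h
  -- Writing the input term as a difference makes it a continuous function without separate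
  -- continuity proofs for `Q` and `R`.
  refine tendsto_zero_of_summable_norm_pow hsum (w := fun k => x (k + 1) - S.stepOp (x k))
    (fun k => (add_sub_cancel _ _).symm) ?_
  obtain ⟨C, hC0, hC⟩ := S.exists_norm_opQ_le
  have hlim : Tendsto (fun k => C * ‖u k‖ + C * ‖u (k + 1)‖) atTop (𝓝 0) := by
    have hu0 : Tendsto (fun k => ‖u k‖) atTop (𝓝 0) := by simpa using Tendsto.norm hu
    simpa using (hu0.const_mul C).add ((hu0.comp (tendsto_add_atTop_nat 1)).const_mul C)
  refine squeeze_zero_norm (fun k => ?_) hlim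
  refine (ContinuousMap.norm_le _ (by positivity)).2 fun t => ?_
  rw [ContinuousMap.sub_apply, stepOp_apply, hux k t, add_assoc, add_sub_cancel_left]
  exact norm_add_le_of_le (hC _ t).1 (hC _ t).2

end Discrete

/-! ### The continuous-time relation -/

section Continuous

/-- Signals are constrained only on `[0, ∞)`; freezing them at negative times yields the continuity
on `ℝ` required of solutions. -/
theorem continuous_comp_max {Y : Type*} [TopologicalSpace Y] {y : ℝ → Y}
    (hy : ContinuousOn y (Ici 0)) : Continuous fun t => y (max 0 t) :=
  hy.comp_continuous (by fun_prop) fun t => mem_Ici.2 (le_max_left _ _)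

variable [CompleteSpace X]

/-- Restart the homogeneous flow from the `k`-th segment. Its difference from the trajectory has
zero initial segment and inhomogeneity `w`, so over the next segment it is bounded by late values of
`w`. -/
theorem isVIVO_rel [ProperSpace X]
    (h : ∀ (c : ℂ) (v : C(Icc (0 : ℝ) S.tmax, X)), 1 ≤ ‖c‖ → S.stepOp v = c • v → v = 0) :
    IsVIVO S.rel := by
  rintro u x ⟨hu, hx, hux⟩ hu0
  dsimp only at hu hx hux
  have hsum := summable_norm_pow_of_isCompactOperator S.isCompactOperator_stepOp h
  have htm := S.tmax_pos
  set y : ℝ → X := fun t => x (max 0 t) with hy_def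
  set w : ℝ → X := fun t => ∑ j, S.B j (u (max 0 (t - S.delay j))) with hw_def
  have hy : Continuous y := continuous_comp_max hx.continuousOn
  have hw : Continuous w := continuous_finsetSum _ fun j _ => (S.B j).continuous.comp
    ((continuous_comp_max hu.continuousOn).comp (by fun_prop : Continuous fun t => t - S.delay j))
  have hsol : S.IsSolution w y := by
    intro t ht
    have heq : y =ᶠ[𝓝 t] x := by
      filter_upwards [Ioi_mem_nhds (htm.trans_le ht)] with s hs
      simp only [hy_def, max_eq_right (mem_Ioi.1 hs).le]
    refine (((hux t ht).congr_of_eventuallyEq heq).congr_deriv ?_).hasDerivWithinAt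
    rw [Finset.sum_add_distrib]
    have : ∀ j, max 0 (t - S.delay j) = t - S.delay j := fun j =>
      max_eq_right (by linarith [S.delay_le_tmax j])
    simp only [hy_def, hw_def, this]
  have hw0 : Tendsto w atTop (𝓝 0) := by
    have : ∀ j, Tendsto (fun t => S.B j (u (max 0 (t - S.delay j)))) atTop (𝓝 0) := fun j => by
      have h1 : Tendsto (fun t => max 0 (t - S.delay j)) atTop atTop :=
        tendsto_atTop_mono (fun t => le_max_right _ _)
          (tendsto_atTop_add_const_right _ (-S.delay j) tendsto_id)
      simpa [Function.comp_def] using ((S.B j).continuous.tendsto 0).comp (Tendsto.comp hu0 h1)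
    simpa using tendsto_finsetSum Finset.univ fun j _ => this j
  let xd : ℕ → C(Icc (0 : ℝ) S.tmax, X) := fun k =>
    ⟨fun t => y (t + k * S.tmax), hy.comp (by fun_prop)⟩
  obtain ⟨C, hC0, hC⟩ := S.exists_norm_solution_le (2 * S.tmax)
  have hxd : Tendsto xd atTop (𝓝 0) := by
    refine tendsto_zero_of_summable_norm_pow hsum (w := fun k => xd (k + 1) - S.stepOp (xd k))
      (fun k => (add_sub_cancel _ _).symm) ?_
    rw [NormedAddGroup.tendsto_nhds_zero]
    intro ε hε
    -- Dividing by `C + 1` gives `C * (ε / (C + 1)) < ε` even when `C = 0`.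
    have hε' : 0 < ε / (C + 1) := by positivity
    rw [NormedAddGroup.tendsto_nhds_zero] at hw0
    obtain ⟨R, hR⟩ := eventually_atTop.1 (hw0 _ hε')
    have hk : Tendsto (fun k : ℕ => (k : ℝ) * S.tmax) atTop atTop :=
      tendsto_natCast_atTop_atTop.atTop_mul_const htm
    filter_upwards [hk.eventually_ge_atTop R] with k hkR
    have hk0 : 0 ≤ (k : ℝ) * S.tmax := by positivity
    have hsub := (hsol.comp_add hk0).sub (S.isSolution_flow (xd k))
    have hle := hC _ _ (ε / (C + 1))
      ((hw.comp (by fun_prop : Continuous fun t => t + k * S.tmax)).sub continuous_zero)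
      ((hy.comp (by fun_prop : Continuous fun t => t + k * S.tmax)).sub
        (S.continuous_flow (xd k))) hsub
      (fun t ht => by
        have := S.flow_coe (xd k) ⟨t, ht⟩
        simp only [Pi.sub_apply, this]
        simpa [xd] using hε'.le)
      (fun t ht => by
        simpa using (hR (t + k * S.tmax) (by linarith [ht.1])).le)
    have hlt : C * (ε / (C + 1)) < ε := by
      rw [mul_div_assoc', div_lt_iff₀ (by positivity)]
      nlinarith
    refine lt_of_le_of_lt ((ContinuousMap.norm_le _ (by positivity)).2 fun t => ?_) hlt
    have := hle (S.tmax + t) ⟨by linarith [t.2.1], by linarith [t.2.2]⟩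
    rw [ContinuousMap.sub_apply, stepOp_apply, opP_eq_flow]
    have heq : xd (k + 1) t = y (S.tmax + t + k * S.tmax) := by
      change y _ = y _
      congr 1
      push_cast
      ring
    rw [heq]
    exact this
  have hfloor : Tendsto (fun t : ℝ => ⌊t / S.tmax⌋₊) atTop atTop :=
    tendsto_nat_floor_atTop.comp (tendsto_id.atTop_div_const htm)
  have hlim : Tendsto (fun t : ℝ => ‖xd ⌊t / S.tmax⌋₊‖) atTop (𝓝 0) := by
    simpa using (hxd.comp hfloor).norm
  refine squeeze_zero_norm' ?_ hlim
  filter_upwards [eventually_ge_atTop 0] with t ht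
  have h1 := Nat.floor_le (show 0 ≤ t / S.tmax by positivity)
  have h2 := (Nat.lt_floor_add_one (t / S.tmax)).le
  rw [le_div_iff₀ htm] at h1
  rw [div_le_iff₀ htm] at h2
  refine le_trans (le_of_eq ?_) ((xd ⌊t / S.tmax⌋₊).norm_coe_le_norm
    ⟨t - ⌊t / S.tmax⌋₊ * S.tmax, by linarith, by linarith⟩)
  simp [xd, hy_def, ht]

omit [CompleteSpace X] in
-- The coefficients and delays are constant, so both sides of the equation can be differentiated.
theorem derivWithin_mem_rel {u : ℝ → U} {x : ℝ → X} (h : (u, x) ∈ S.rel) :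
    (derivWithin u (Ici 0), derivWithin x (Ici 0)) ∈ S.rel := by
  obtain ⟨hu, hx, hux⟩ := h
  dsimp only at hu hx hux
  have hu' := hu.derivWithin (m := ∞) (uniqueDiffOn_Ici 0) (by simp)
  have hx' := hx.derivWithin (m := ∞) (uniqueDiffOn_Ici 0) (by simp)
  refine ⟨hu', hx', fun t ht => ?_⟩
  dsimp only
  have ht0 : 0 < t := S.tmax_pos.trans_le ht
  have hd := ((hx'.differentiableOn (by simp)) t ht0.le).differentiableAt (Ici_mem_nhds ht0)
  have hcomp : ∀ (j : Fin (S.m + 1)), MapsTo (fun s => s - S.delay j) (Ici t) (Ici 0) :=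
    fun j s hs => by
      have := S.delay_le_tmax j
      simp only [mem_Ici] at hs ⊢
      linarith
  have hshift : ∀ (j : Fin (S.m + 1)),
      HasDerivWithinAt (fun s : ℝ => s - S.delay j) 1 (Ici t) t := fun j =>
    ((hasDerivAt_id t).sub_const _).hasDerivWithinAt
  have hX : ∀ j, HasDerivWithinAt (fun s => S.A j (x (s - S.delay j)))
      (S.A j (derivWithin x (Ici 0) (t - S.delay j))) (Ici t) t := fun j => by
    have h1 := (hx.differentiableOn (by simp) (t - S.delay j)
      (hcomp j self_mem_Ici)).hasDerivWithinAt
    have h2 := h1.scomp (h := fun s : ℝ => s - S.delay j) t (hshift j) (hcomp j)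
    rw [one_smul] at h2
    exact ((S.A j).restrictScalars ℝ).hasFDerivAt.comp_hasDerivWithinAt t h2
  have hU : ∀ j, HasDerivWithinAt (fun s => S.B j (u (s - S.delay j)))
      (S.B j (derivWithin u (Ici 0) (t - S.delay j))) (Ici t) t := fun j => by
    have h1 := (hu.differentiableOn (by simp) (t - S.delay j)
      (hcomp j self_mem_Ici)).hasDerivWithinAt
    have h2 := h1.scomp (h := fun s : ℝ => s - S.delay j) t (hshift j) (hcomp j)
    rw [one_smul] at h2
    exact ((S.B j).restrictScalars ℝ).hasFDerivAt.comp_hasDerivWithinAt t h2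
  have hrhs := HasDerivWithinAt.fun_sum (u := Finset.univ) fun j _ => (hX j).add (hU j)
  have heq : ∀ s ∈ Ici t, derivWithin x (Ici 0) s =
      ∑ j, (S.A j (x (s - S.delay j)) + S.B j (u (s - S.delay j))) := fun s hs => by
    rw [derivWithin_of_mem_nhds (Ici_mem_nhds (ht0.trans_le hs))]
    exact (hux s (ht.trans hs)).deriv
  have hrhs' := hrhs.congr_of_mem heq self_mem_Ici
  -- At `t = t_m` the equation is available only to the right. Smoothness supplies a two-sided
  -- derivative, and comparing right derivatives identifies it.
  rw [← (uniqueDiffWithinAt_Ici t).eq_deriv _ hd.hasDerivAt.hasDerivWithinAt hrhs']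
  exact hd.hasDerivAt

omit [CompleteSpace X] in
theorem iteratedDerivWithin_mem_rel {u : ℝ → U} {x : ℝ → X} (h : (u, x) ∈ S.rel) (k : ℕ) :
    (iteratedDerivWithin k u (Ici 0), iteratedDerivWithin k x (Ici 0)) ∈ S.rel := by
  induction k with
  | zero => simpa only [iteratedDerivWithin_zero] using h
  | succ k ih =>
    rw [iteratedDerivWithin_succ, iteratedDerivWithin_succ]
    exact derivWithin_mem_rel ih

omit [CompleteSpace X] in
theorem isSmoothlyVIVO_rel (h : IsVIVO S.rel) : IsSmoothlyVIVO S.rel :=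
  fun _ _ hux hu k => h _ _ (iteratedDerivWithin_mem_rel hux k) (hu k)

/-- The difference of the two sides is a homogeneous solution vanishing on `[0, t_m]`; the a priori
bound with `M = 0` makes it vanish afterwards. -/
theorem flow_add_tmax {c : ℂ} {v : C(Icc (0 : ℝ) S.tmax, X)} (hv : S.stepOp v = c • v)
    {t : ℝ} (ht : 0 ≤ t) : S.flow v (t + S.tmax) = c • S.flow v t := by
  obtain ⟨C, hC0, hC⟩ := S.exists_norm_solution_le t
  have hcont := S.continuous_flow v
  have hsol := ((S.isSolution_flow v).comp_add S.tmax_nonneg).sub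
    ((S.isSolution_flow v).const_smul c)
  have := hC _ _ 0 (by simpa using! continuous_zero)
    ((hcont.comp (by fun_prop : Continuous fun t => t + S.tmax)).sub (hcont.const_smul c)) hsol
    (fun s hs => ?_) (fun s _ => by simp) t (right_mem_Icc.2 ht)
  · simpa [sub_eq_zero] using this
  · have h1 := congrArg (fun g => g ⟨s, hs⟩) hv
    simp only [stepOp_apply, opP_eq_flow, ContinuousMap.smul_apply] at h1
    simp [← S.flow_coe v ⟨s, hs⟩, add_comm s] at h1 ⊢
    rw [h1, sub_self]

/-- The derivative at `t` is read off at `t + t_m`, where the equation holds, even for `t` in the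
initial segment. -/
theorem hasDerivWithinAt_flow {c : ℂ} (hc : c ≠ 0) {v : C(Icc (0 : ℝ) S.tmax, X)}
    (hv : S.stepOp v = c • v) {t : ℝ} (ht : 0 ≤ t) : HasDerivWithinAt (S.flow v)
      (c⁻¹ • ∑ j, S.A j (S.flow v (t + S.tmax - S.delay j))) (Ici 0) t := by
  have hcont := S.continuous_flow v
  have h1 := hasDerivAt_of_variation hcont continuous_zero
    (fun t ht => (S.isSolution_flow v).eq_variation hcont continuous_zero ht)
    (show S.tmax ≤ t + S.tmax by linarith)
  have h2 : HasDerivWithinAt (fun s : ℝ => s + S.tmax) 1 (Ici 0) t :=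
    ((hasDerivAt_id t).add_const _).hasDerivWithinAt
  have h3 := (HasDerivWithinAt.scomp (h := fun s : ℝ => s + S.tmax) t h1 h2
    (fun s hs => by simpa using hs)).const_smul c⁻¹
  rw [one_smul, Pi.zero_apply, add_zero] at h3
  refine h3.congr_of_mem (fun s hs => ?_) ht
  simp only [Pi.smul_apply, Function.comp_apply]
  rw [flow_add_tmax hv hs, inv_smul_smul₀ hc]

/-- Bootstrapping: the derivative combines values of the flow at the nonnegative times `t + t_m -
t_j`, so it is as regular as the flow itself. -/
theorem contDiffOn_flow {c : ℂ} (hc : c ≠ 0) {v : C(Icc (0 : ℝ) S.tmax, X)}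
    (hv : S.stepOp v = c • v) : ContDiffOn ℝ ∞ (S.flow v) (Ici 0) := by
  rw [contDiffOn_infty]
  intro n
  induction n with
  | zero => simpa using (S.continuous_flow v).continuousOn
  | succ n ih =>
    push_cast
    rw [contDiffOn_succ_iff_derivWithin (uniqueDiffOn_Ici 0)]
    refine ⟨fun t ht => (hasDerivWithinAt_flow hc hv ht).differentiableWithinAt, by simp, ?_⟩
    refine ContDiffOn.congr (f := fun t =>
      c⁻¹ • ∑ j, S.A j (S.flow v (t + S.tmax - S.delay j))) ?_ fun t ht =>
        (hasDerivWithinAt_flow hc hv ht).derivWithin (uniqueDiffOn_Ici 0 t ht)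
    refine ContDiffOn.const_smul c⁻¹ (ContDiffOn.sum fun j _ => ?_)
    refine ((S.A j).restrictScalars ℝ).contDiff.comp_contDiffOn
      (ih.comp (by fun_prop : ContDiff ℝ n fun t => t + S.tmax - S.delay j).contDiffOn
        fun t ht => ?_)
    have := S.delay_le_tmax j
    simp only [mem_Ici] at ht ⊢
    linarith

theorem flow_mem_rel {c : ℂ} (hc : c ≠ 0) {v : C(Icc (0 : ℝ) S.tmax, X)}
    (hv : S.stepOp v = c • v) : ((0 : ℝ → U), S.flow v) ∈ S.rel := by
  refine ⟨contDiffOn_const, contDiffOn_flow hc hv, fun t ht => ?_⟩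
  have ht0 : 0 < t := S.tmax_pos.trans_le ht
  refine ((hasDerivWithinAt_flow hc hv ht0.le).hasDerivAt (Ici_mem_nhds ht0)).congr_deriv ?_
  simp only [Pi.zero_apply, map_zero, add_zero, Finset.smul_sum]
  refine Finset.sum_congr rfl fun j _ => ?_
  rw [add_sub_right_comm, flow_add_tmax hv (by linarith [S.delay_le_tmax j]), map_smul,
    inv_smul_smul₀ hc]

/-- Along `t + n t_m` the flow equals `c ^ n • v t`, whose norm never drops below `‖v t‖`, while
stability sends it to `0`. -/
theorem eigenvector_eq_zero_of_isStableRel (h : IsStableRel S.rel)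
    (c : ℂ) (v : C(Icc (0 : ℝ) S.tmax, X)) (hc : 1 ≤ ‖c‖) (hv : S.stepOp v = c • v) : v = 0 := by
  have hc0 : c ≠ 0 := by
    rintro rfl
    norm_num at hc
  have hlim : Tendsto (S.flow v) atTop (𝓝 0) := h _ (flow_mem_rel hc0 hv)
  ext1 t
  have hpow : ∀ n : ℕ, S.flow v (t + n * S.tmax) = c ^ n • v t := by
    intro n
    induction n with
    | zero => simp [flow_coe]
    | succ n ih =>
      have := S.tmax_nonneg
      rw [pow_succ', mul_smul, ← ih, ← flow_add_tmax hv (by have := t.2.1; positivity)]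
      congr 1
      push_cast
      ring
  have hn : Tendsto (fun n : ℕ => (t : ℝ) + n * S.tmax) atTop atTop :=
    tendsto_atTop_add_const_left _ _ (tendsto_natCast_atTop_atTop.atTop_mul_const S.tmax_pos)
  have h0 : Tendsto (fun n : ℕ => ‖S.flow v (t + n * S.tmax)‖) atTop (𝓝 0) := by
    simpa using (hlim.comp hn).norm
  have : ‖v t‖ ≤ 0 := ge_of_tendsto' h0 fun n => by
    rw [hpow, norm_smul, norm_pow]
    exact le_mul_of_one_le_left (norm_nonneg _) (one_le_pow₀ hc)
  simpa using this

end Continuous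

end DelayEquation

end

/-! ### The equivalence -/

theorem mainTheorem9 {U X : Type*} [NormedAddCommGroup U] [NormedSpace ℂ U]
    [FiniteDimensional ℂ U] [NormedAddCommGroup X] [NormedSpace ℂ X] [FiniteDimensional ℂ X]
    (S : DelayEquation U X) :
    List.TFAE [
      ∀ (x : ℕ → C(Icc (0 : ℝ) S.tmax, X)) (c : ℂ), (0, x) ∈ S.discreteRel → 1 ≤ ‖c‖ →
        (∀ k, x (k + 1) = c • x k) → x = 0,
      IsStableRel S.discreteRel,
      IsVIVO S.discreteRel,
      IsVIVO S.rel,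
      IsSmoothlyVIVO S.rel,
      IsStableRel S.rel] := by
  have : CompleteSpace X := FiniteDimensional.complete ℂ X
  have : ProperSpace X := FiniteDimensional.proper ℂ X
  tfae_have 1 → 3 := fun h =>
    DelayEquation.isVIVO_discreteRel (DelayEquation.eigenvector_eq_zero_of_geometric h)
  tfae_have 3 → 2 := fun h x hx => h 0 x hx tendsto_const_nhds
  tfae_have 2 → 1 := by
    intro h x c hx hc hxc
    have hpow : ∀ k, x k = c ^ k • x 0 := fun k => by
      induction k with
      | zero => simp
      | succ k ih => rw [hxc, ih, smul_smul, pow_succ']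
    have h0 : Tendsto (fun k => ‖x k‖) atTop (𝓝 0) := by simpa using Tendsto.norm (h x hx)
    have : ‖x 0‖ ≤ 0 := ge_of_tendsto' h0 fun k => by
      rw [hpow k, norm_smul, norm_pow]
      exact le_mul_of_one_le_left (norm_nonneg _) (one_le_pow₀ hc)
    ext1 k
    rw [hpow k, norm_le_zero_iff.1 this, smul_zero, Pi.zero_apply]
  tfae_have 1 → 4 := fun h =>
    DelayEquation.isVIVO_rel (DelayEquation.eigenvector_eq_zero_of_geometric h)
  tfae_have 4 → 5 := DelayEquation.isSmoothlyVIVO_rel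
  tfae_have 5 → 6 := by
    intro h x hx
    have h0 : VanishesSmoothly (0 : ℝ → U) := fun k => by
      rw [show iteratedDerivWithin k (0 : ℝ → U) (Ici 0) = 0 from
        funext fun t => iteratedDerivWithin_const_zero]
      exact tendsto_const_nhds
    simpa only [iteratedDerivWithin_zero] using h 0 x hx h0 0
  tfae_have 6 → 1 := by
    intro h x c hx hc hxc
    have h0 := DelayEquation.eigenvector_eq_zero_of_isStableRel h c (x 0) hc
      (DelayEquation.stepOp_eq_of_geometric hx hxc)
    ext1 k
    induction k with
    | zero => exact h0
    | succ k ih => rw [hxc, ih, Pi.zero_apply, Pi.zero_apply, smul_zero]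
  tfae_finish
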